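/- A partition is a weakly decreasing finite sequence $\lambda=(\lambda_1\ge\dots\ge\lambda_\ell>0)$ of integers; write $\ell(\lambda)=\ell$, $|\lambda|=\sum_i\lambda_i$, $\lambda_i=0$ for $i>\ell$, and let $Y_\lambda=\{(i,j): 1\le i\le \ell,\ 1\le j\le\lambda_i\}$ be its Young diagram. For $a\in\{1,2\}$ put $(t_1,t_2)=(0,1)$ if $a=1$ and $(t_1,t_2)=(0,0)$ if $a=2$. Let $\Lambda^{a,2}(n)$ be the set of pairs $\lambda=(\lambda^{(1)},\lambda^{(2)})$ of partitions with $|\lambda^{(1)}|+|\lambda^{(2)}|=n$ such that (i) $\lambda^{(s)}_i-\lambda^{(s)}_{i+1}<2$ for $s=1,2$ and all $1\le i\le\ell(\lambda^{(s)})$, and (ii) $\ell(\lambda^{(1)})+t_1\le\lambda^{(2)}_1+t_2$. The node $(i,j)$ of $Y_{\lambda^{(s)}}$ has residue $(j-i+t_s)\bmod 2$, and the $2$-residue $\omega(\lambda)\in\mathbb Z$ is the number of nodes (in both diagrams) of residue $0$ minus the number of nodes of residue $1$. For an integer $\omega$ let $\Lambda^{a,2}_\omega(n)=\{\lambda\in\Lambda^{a,2}(n):\omega(\lambda)=\omega\}$.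 Then for every integer $\omega$, as formal power series in $x$, $$\sum_{n\ge0}|\Lambda^{1,2}_\omega(n)|\,x^n=x^{\omega^2}\prod_{n\ge1}\frac{1+x^{2n}}{1-x^{2n}},$$ and $\sum_{n\ge0}|\Lambda^{2,2}_\omega(n)|\,x^n$ consists of the terms with exponent congruent to $\omega$ modulo $2$ of $$x^{\omega^2-\omega}\prod_{n\ge1}\frac{1+x^{2n-1}}{1-x^{2n}};$$ that is, $|\Lambda^{2,2}_\omega(n)|$ is the coefficient of $x^n$ in this series if $n\equiv\omega\pmod 2$, and $\Lambda^{2,2}_\omega(n)=\emptyset$ if $n\not\equiv\omega\pmod 2$. -/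

import Mathlib

open scoped PowerSeries.WithPiTopology

/-- An `m`-multipartition: an `m`-tuple of partitions. A partition `l` is given by its Young diagram
(English convention, rows and columns indexed from `0`): `l.rowLen i` is the `(i+1)`-st part of `l`
(which is `0` past the last part), `l.colLen 0` is the number of parts and `l.card` is the size. -/
abbrev Multipartition (m : ℕ) : Type := Fin m → YoungDiagram

/-- A partition is `e`-restricted if `l_i - l_{i+1} < e` for `1 ≤ i ≤ ℓ(l)`, where `l_{ℓ(l)+1} = 0`. -/
def YoungDiagram.IsRestricted (e : ℕ) (l : YoungDiagram) : Prop :=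
  ∀ i < l.colLen 0, l.rowLen i < l.rowLen (i + 1) + e

namespace Multipartition

variable {m : ℕ}

/-- The size of a multipartition, the sum of the sizes of its components. -/
def size (l : Multipartition m) : ℕ := ∑ s, (l s).card

/-- `(e, t)`-restricted multipartitions: each component is `e`-restricted, and
`ℓ(l^(i)) + t_i ≤ l^(i+1)_1 + t_{i+1}` for any two consecutive components. -/
def IsRestricted (e : ℕ) (t : Fin m → ℕ) (l : Multipartition m) : Prop :=
  (∀ s, (l s).IsRestricted e) ∧
    ∀ (i : ℕ) (h : i + 1 < m),
      (l ⟨i, by omega⟩).colLen 0 + t ⟨i, by omega⟩ ≤ (l ⟨i + 1, h⟩).rowLen 0 + t ⟨i + 1, h⟩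

/-- The nodes of a multipartition: a component index `s`, with a (row, column) position in the Young
diagram of the component `s`. -/
def nodes (l : Multipartition m) : Finset (Σ _ : Fin m, ℕ × ℕ) :=
  Finset.univ.sigma fun s => (l s).cells

/-- The `p`-residue `j - i + t_s` modulo `p` of the node in row `i` and column `j` of component `s`. -/
def residue (p : ℕ) (t : Fin m → ℕ) (x : Σ _ : Fin m, ℕ × ℕ) : ZMod p :=
  (x.2.2 : ZMod p) - (x.2.1 : ZMod p) + (t x.1 : ZMod p)

/-- The number of nodes with `2`-residue `r`. -/
def residueCount (t : Fin m → ℕ) (l : Multipartition m) (r : ZMod 2) : ℕ :=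
  (l.nodes.filter fun x => residue 2 t x = r).card

/-- The `2`-residue of a multipartition: the number of nodes of residue `0` minus the number of
nodes of residue `1`. -/
def twoResidue (t : Fin m → ℕ) (l : Multipartition m) : ℤ :=
  (residueCount t l 0 : ℤ) - (residueCount t l 1 : ℤ)

/-- The sequence `t_1 = ⋯ = t_a = 0`, `t_{a+1} = ⋯ = t_m = 1`. -/
def shift (a m : ℕ) (s : Fin m) : ℕ := if (s : ℕ) < a then 0 else 1

/-- The `(2, t)`-restricted `m`-multipartitions of `n`, with `t` as in `shift a m`. -/
def Lam (a m n : ℕ) : Set (Multipartition m) :=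
  {l | l.IsRestricted 2 (shift a m) ∧ l.size = n}

/-- The multipartitions in `Lam a m n` with `2`-residue `ω`. -/
def LamRes (a m : ℕ) (ω : ℤ) (n : ℕ) : Set (Multipartition m) :=
  {l | l ∈ Lam a m n ∧ l.twoResidue (shift a m) = ω}

/-- There are finitely many multipartitions of `n`, so that cardinalities are genuine. -/
theorem finite_size_eq (m n : ℕ) : {l : Multipartition m | l.size = n}.Finite := by
  have h1 : {d : YoungDiagram | d.card ≤ n}.Finite := by
    apply Set.Finite.of_finite_image (f := YoungDiagram.cells)
    · apply ((Finset.range n ×ˢ Finset.range n).powerset.finite_toSet).subset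
      rintro _ ⟨d, hd, rfl⟩
      simp only [Finset.coe_powerset, Set.mem_preimage, Set.mem_powerset_iff, Finset.coe_subset]
      rintro ⟨i, j⟩ hc
      have hc' : (i, j) ∈ d := hc
      have hr : d.rowLen 0 ≤ d.card := by
        rw [d.rowLen_eq_card]; exact Finset.card_le_card (Finset.filter_subset _ _)
      have hl : d.colLen 0 ≤ d.card := by
        rw [d.colLen_eq_card]; exact Finset.card_le_card (Finset.filter_subset _ _)
      have hi := YoungDiagram.mem_iff_lt_colLen.1 (d.up_left_mem le_rfl (Nat.zero_le j) hc')
      have hj := YoungDiagram.mem_iff_lt_rowLen.1 (d.up_left_mem (Nat.zero_le i) le_rfl hc')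
      have hd' : d.card ≤ n := hd
      simp only [Finset.mem_product, Finset.mem_range]
      omega
    · intro d _ d' _ h
      exact YoungDiagram.ext h
  refine (Set.Finite.pi' (fun _ : Fin m => h1)).subset fun l hl s => ?_
  have hl' : ∑ s, (l s).card = n := hl
  exact hl' ▸ Finset.single_le_sum (f := fun s => (l s).card) (fun _ _ => Nat.zero_le _)
    (Finset.mem_univ s)

theorem finite_LamRes (a m : ℕ) (ω : ℤ) (n : ℕ) : (LamRes a m ω n).Finite :=
  (finite_size_eq m n).subset fun _ hl => hl.1.2

/-- The generating function of the numbers of multipartitions of `n` in `LamRes a m ω n`. -/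
noncomputable def genFun (a m : ℕ) (ω : ℤ) : PowerSeries ℚ :=
  PowerSeries.mk fun n => ((LamRes a m ω n).ncard : ℚ)

end Multipartition

/-! Call the nodes with `i + j + t_s = m` (from zero) the `m`-th ladder. Since signs vanish modulo
2, the residue of a node is the parity of its ladder. A restricted bipartition is determined by its
ladder counts `C`, and the admissible `C` are cut out by inequalities between neighbouring entries.
With the entries of one parity fixed, the others range independently over intervals; reversing these
intervals is an involution, `ladderReflect`. The two involutions act on the pair of residue counts
as the simple reflections of an infinite dihedral group (the affine Weyl group of type A_1). Hence,
up to an explicit power of x, the series G_ω depends only on ω mod 2, and for a = 1 not on ω at all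
(`genFun_one_two`, `genFun_two_two`).

The sum over all ω is computed independently. The columns of a 2-restricted partition have distinct
lengths, so with d = t_2 the sum is Σ_T x^|T| ∏_{i ≤ #T+d} (1 + x^i) over strict partitions T, and
Lebesgue's identity makes it a product. It also equals a theta series, Σ x^(ω²) or Σ x^(ω²-ω), times
an unknown series; Jacobi's triple product evaluates the theta series, and division gives the
unknown. For a = 2, pairing ω with 1 - ω leaves G_0 + G_1 as the unknown, and n ≡ ω mod 2 separates
the two summands.

Both identities are proved in finite form and used modulo powers of X; infinite products enter only
at the end. -/

/-! ### Gaussian binomials; finite Lebesgue and Jacobi identities. -/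

section QSeries

variable {R : Type*} [CommRing R]

/-- The Gaussian binomial coefficient, evaluated at `q`. -/
def gaussBinom (q : R) : ℕ → ℕ → R
  | _, 0 => 1
  | 0, _ + 1 => 0
  | n + 1, k + 1 => gaussBinom q n k + q ^ (k + 1) * gaussBinom q n (k + 1)

/-- The `q`-factorial `(1 - q) ⋯ (1 - q ^ n)`. -/
def qFac (q : R) (n : ℕ) : R := ∏ i ∈ Finset.range n, (1 - q ^ (i + 1))

@[simp] theorem gaussBinom_zero_right (q : R) (n : ℕ) : gaussBinom q n 0 = 1 := by
  cases n <;> rfl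

@[simp] theorem gaussBinom_zero_succ (q : R) (k : ℕ) : gaussBinom q 0 (k + 1) = 0 := rfl

theorem gaussBinom_succ_succ (q : R) (n k : ℕ) : gaussBinom q (n + 1) (k + 1) =
    gaussBinom q n k + q ^ (k + 1) * gaussBinom q n (k + 1) := rfl

theorem gaussBinom_eq_zero_of_lt (q : R) {n k : ℕ} (h : n < k) : gaussBinom q n k = 0 := by
  induction n generalizing k with
  | zero => obtain ⟨k, rfl⟩ := Nat.exists_eq_add_of_lt h; simp
  | succ n ih =>
    obtain _ | k := k
    · omega
    · rw [gaussBinom_succ_succ, ih (by omega), ih (by omega)]; simp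

/-- The second Pascal rule, whose coefficient is q^(n-k), multiplied by q^k so that no exponent is a
difference. -/
theorem gaussBinom_succ_succ' (q : R) (n k : ℕ) : q ^ k * gaussBinom q (n + 1) (k + 1) =
    q ^ k * gaussBinom q n (k + 1) + q ^ n * gaussBinom q n k := by
  induction n generalizing k with
  | zero => obtain _ | k := k <;> simp [gaussBinom_succ_succ]
  | succ n ih =>
    obtain _ | k := k
    · have h := ih 0
      have h3 := gaussBinom_succ_succ q n 0
      have h4 := gaussBinom_succ_succ q (n + 1) 0
      simp only [pow_zero, one_mul, zero_add, gaussBinom_zero_right, mul_one, pow_one] at h h3 h4 ⊢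
      linear_combination h4 + q * h - h3
    · have h1 := ih k
      have h2 := ih (k + 1)
      rw [gaussBinom_succ_succ q (n + 1) (k + 1)]
      have h3 := gaussBinom_succ_succ q n (k + 1)
      have h4 := gaussBinom_succ_succ q n k
      linear_combination q * h1 + q ^ (k + 2) * h2 - q ^ (k + 1) * h3 - q ^ (n + 1) * h4

theorem gaussBinom_succ_mul (q : R) (n k : ℕ) : gaussBinom q (n + 1) (k + 1) * (1 - q ^ (k + 1)) =
    (1 - q ^ (n + 1)) * gaussBinom q n k := by
  linear_combination gaussBinom_succ_succ q n k - q * gaussBinom_succ_succ' q n k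

theorem gaussBinom_mul_qFac (q : R) (m j : ℕ) : gaussBinom q (m + j) j * qFac q j =
    ∏ i ∈ Finset.range j, (1 - q ^ (m + i + 1)) := by
  induction j with
  | zero => simp [qFac]
  | succ j ih =>
    rw [Finset.prod_range_succ, ← ih, qFac, Finset.prod_range_succ, ← qFac]
    linear_combination qFac q j * gaussBinom_succ_mul q (m + j) j

theorem choose_two_succ (k : ℕ) : (k + 1).choose 2 = k.choose 2 + k := by
  rw [Nat.choose_succ_succ' k 1]; simp [add_comm]

/-- The `q`-binomial theorem. -/
theorem prod_add_mul_pow (q u v : R) (n : ℕ) : ∏ i ∈ Finset.range n, (u + v * q ^ i) =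
    ∑ j ∈ Finset.range (n + 1), gaussBinom q n j * q ^ j.choose 2 * v ^ j * u ^ (n - j) := by
  induction n generalizing v with
  | zero => simp
  | succ n ih =>
    have h1 : ∏ i ∈ Finset.range n, (u + v * q ^ (i + 1)) =
        ∏ i ∈ Finset.range n, (u + (v * q) * q ^ i) :=
      Finset.prod_congr rfl fun i _ => by ring
    rw [Finset.prod_range_succ', h1, ih, Finset.sum_range_succ' _ (n + 1)]
    have h2 : ∀ j, gaussBinom q (n + 1) (j + 1) * q ^ (j + 1).choose 2 * v ^ (j + 1) *
        u ^ (n + 1 - (j + 1)) =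
        v * (gaussBinom q n j * q ^ j.choose 2 * (v * q) ^ j * u ^ (n - j)) +
        gaussBinom q n (j + 1) * q ^ (j + 1).choose 2 * (v * q) ^ (j + 1) *
          u ^ (n + 1 - (j + 1)) := by
      intro j
      rw [gaussBinom_succ_succ, choose_two_succ, Nat.add_sub_add_right]
      ring
    rw [Finset.sum_congr rfl fun j _ => h2 j, Finset.sum_add_distrib, ← Finset.mul_sum, add_assoc]
    have h3 : ∑ j ∈ Finset.range (n + 1), gaussBinom q n (j + 1) * q ^ (j + 1).choose 2 *
        (v * q) ^ (j + 1) * u ^ (n + 1 - (j + 1)) +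
        gaussBinom q (n + 1) 0 * q ^ Nat.choose 0 2 * v ^ 0 * u ^ (n + 1 - 0) =
        u * ∑ j ∈ Finset.range (n + 1),
          gaussBinom q n j * q ^ j.choose 2 * (v * q) ^ j * u ^ (n - j) := by
      rw [Finset.sum_range_succ, gaussBinom_eq_zero_of_lt q (Nat.lt_succ_self n),
        Finset.sum_range_succ' _ n, mul_add, Finset.mul_sum]
      simp only [zero_mul, add_zero]
      congr 1
      · refine Finset.sum_congr rfl fun j hj => ?_
        have : n + 1 - (j + 1) = n - (j + 1) + 1 := by have := Finset.mem_range.1 hj; omega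
        rw [this]; ring
      · simp; ring
    rw [h3]
    ring

/-- The sum of `f` over subsets of `{1, …, n}`, represented as subsets of `range n`. -/
theorem sum_powerset_range_succ {M : Type*} [AddCommMonoid M] (f : Finset ℕ → M) (n : ℕ) :
    ∑ T ∈ (Finset.range (n + 1)).powerset, f T = ∑ T ∈ (Finset.range n).powerset, f T +
      ∑ T ∈ (Finset.range n).powerset, f (insert n T) := by
  rw [Finset.range_add_one, Finset.sum_powerset_insert Finset.notMem_range_self]

/-- Induction on n, splitting on whether the largest part n + 1 belongs to T; both Pascal rules are
needed to recombine the halves. -/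
theorem sum_powerset_gaussBinom (x : R) (n j : ℕ) :
    ∑ T ∈ (Finset.range n).powerset, (∏ i ∈ T, x ^ (i + 1)) * gaussBinom x T.card j =
      x ^ (j + 1).choose 2 * gaussBinom x n j * ∏ i ∈ Finset.Ico j n, (1 + x ^ (i + 1)) := by
  induction n generalizing j with
  | zero => obtain _ | j := j <;> simp
  | succ n ih =>
    rw [sum_powerset_range_succ]
    have hins : ∀ T ∈ (Finset.range n).powerset,
        (∏ i ∈ insert n T, x ^ (i + 1)) * gaussBinom x (insert n T).card j =
        x ^ (n + 1) * ((∏ i ∈ T, x ^ (i + 1)) * gaussBinom x (T.card + 1) j) := by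
      intro T hT
      have hn : n ∉ T := fun h => Finset.notMem_range_self (Finset.mem_powerset.1 hT h)
      rw [Finset.prod_insert hn, Finset.card_insert_of_notMem hn, mul_assoc]
    rw [Finset.sum_congr rfl hins, ← Finset.mul_sum, ih]
    obtain _ | j := j
    · have h0 := ih 0
      simp only [gaussBinom_zero_right, mul_one] at h0 ⊢
      rw [h0, Finset.prod_Ico_succ_top (Nat.zero_le n)]
      simp
      ring
    · have hs : ∑ T ∈ (Finset.range n).powerset,
          (∏ i ∈ T, x ^ (i + 1)) * gaussBinom x (T.card + 1) (j + 1) =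
          ∑ T ∈ (Finset.range n).powerset, (∏ i ∈ T, x ^ (i + 1)) * gaussBinom x T.card j +
          x ^ (j + 1) * ∑ T ∈ (Finset.range n).powerset,
            (∏ i ∈ T, x ^ (i + 1)) * gaussBinom x T.card (j + 1) := by
        rw [Finset.mul_sum, ← Finset.sum_add_distrib]
        exact Finset.sum_congr rfl fun T _ => by rw [gaussBinom_succ_succ]; ring
      rw [hs, ih, ih, choose_two_succ (j + 1)]
      rcases lt_trichotomy n j with h | rfl | h
      · simp [gaussBinom_eq_zero_of_lt x h, gaussBinom_eq_zero_of_lt x (h.trans (Nat.lt_succ_self j)),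
          gaussBinom_eq_zero_of_lt x (Nat.succ_lt_succ h)]
      · rw [gaussBinom_succ_succ, gaussBinom_eq_zero_of_lt x (Nat.lt_succ_self n)]
        simp
        ring
      · rw [Finset.prod_eq_prod_Ico_succ_bot h, Finset.prod_Ico_succ_top h]
        set A := ∏ i ∈ Finset.Ico (j + 1) n, (1 + x ^ (i + 1))
        have h1 := gaussBinom_succ_succ x n j
        have h2 := gaussBinom_succ_succ' x n j
        simp only [pow_add _ ((j + 1).choose 2)]
        set E := x ^ (j + 1).choose 2
        linear_combination - E * A * x * h2 - E * A * x ^ (n + 1) * x ^ (j + 1) * h1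

/-- A finite form of Lebesgue's identity. -/
theorem sum_powerset_prod (x z : R) (n : ℕ) :
    ∑ T ∈ (Finset.range n).powerset, (∏ i ∈ T, x ^ (i + 1)) *
      ∏ i ∈ Finset.range T.card, (1 + z * x ^ (i + 1)) =
    ∑ j ∈ Finset.range (n + 1), (z * x) ^ j * (x ^ 2) ^ j.choose 2 * x ^ j * gaussBinom x n j *
      ∏ i ∈ Finset.Ico j n, (1 + x ^ (i + 1)) := by
  have h1 : ∀ T ∈ (Finset.range n).powerset, (∏ i ∈ T, x ^ (i + 1)) *
      ∏ i ∈ Finset.range T.card, (1 + z * x ^ (i + 1)) =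
      ∑ j ∈ Finset.range (n + 1), (z * x) ^ j * x ^ j.choose 2 *
        ((∏ i ∈ T, x ^ (i + 1)) * gaussBinom x T.card j) := by
    intro T hT
    have hc : T.card ≤ n := by simpa using Finset.card_le_card (Finset.mem_powerset.1 hT)
    have h2 : ∏ i ∈ Finset.range T.card, (1 + z * x ^ (i + 1)) =
        ∏ i ∈ Finset.range T.card, (1 + (z * x) * x ^ i) :=
      Finset.prod_congr rfl fun i _ => by ring
    rw [h2, prod_add_mul_pow, Finset.mul_sum]
    -- Terms with j > #T vanish, so j can run over a range independent of T and the sums can be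
    -- exchanged.
    refine Finset.sum_subset_zero_on_sdiff (Finset.range_mono (by omega)) ?_ ?_
    · intro j hj
      have : T.card < j := by simp at hj; omega
      rw [gaussBinom_eq_zero_of_lt x this]; ring
    · intro j _; simp; ring
  rw [Finset.sum_congr rfl h1, Finset.sum_comm]
  refine Finset.sum_congr rfl fun j _ => ?_
  rw [← Finset.mul_sum, sum_powerset_gaussBinom, choose_two_succ]
  ring

/-- A finite form of Jacobi's triple product identity. -/
theorem prod_mul_prod_eq_sum_gaussBinom (x : R) (s n : ℕ) (hs : s ≤ 1) :
    x ^ (3 * n ^ 2 - s * n) * ((∏ i ∈ Finset.range n, (1 + x ^ (2 * i + 1 - s))) *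
      ∏ i ∈ Finset.range n, (1 + x ^ (2 * i + 1 + s))) =
    ∑ k ∈ Finset.range (2 * n + 1), gaussBinom (x ^ 2) (2 * n) k *
      x ^ (k * (k - s) + 2 * n * (2 * n - k)) := by
  -- The usual choice u = 1, v = x^(1-s-2n) is scaled by x^(2n) in every factor, which removes the
  -- negative exponents.
  have h := prod_add_mul_pow (x ^ 2) (x ^ (2 * n)) (x ^ (1 - s)) (2 * n)
  have h1 : ∀ k ∈ Finset.range (2 * n + 1), gaussBinom (x ^ 2) (2 * n) k * (x ^ 2) ^ k.choose 2 *
      (x ^ (1 - s)) ^ k * (x ^ (2 * n)) ^ (2 * n - k) = gaussBinom (x ^ 2) (2 * n) k *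
      x ^ (k * (k - s) + 2 * n * (2 * n - k)) := by
    intro k _
    rw [mul_assoc, mul_assoc, ← pow_mul, ← pow_mul, ← pow_mul, ← pow_add, ← pow_add]
    congr 2
    rw [← add_assoc]
    congr 1
    have h2 : 2 * k.choose 2 = k * (k - 1) := by
      rw [Nat.choose_two_right, Nat.mul_div_cancel' (Nat.even_mul_pred_self k).two_dvd]
    rw [h2]
    obtain _ | k := k
    · simp
    · interval_cases s <;> simp
      ring
  rw [← Finset.sum_congr rfl h1, ← h, two_mul, Finset.prod_range_add]
  have h3 : ∀ m, ∏ i ∈ Finset.range m, (x ^ (2 * i + 1 - s) * x ^ (2 * m)) =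
      x ^ (3 * m ^ 2 - s * m) := by
    intro m
    rw [Finset.prod_mul_distrib, Finset.prod_const, Finset.prod_pow_eq_pow_sum, ← pow_mul,
      Finset.card_range, ← pow_add]
    congr 1
    have : ∑ i ∈ Finset.range m, (2 * i + 1 - s) + s * m = m ^ 2 := by
      induction m with
      | zero => simp
      | succ m ih =>
        rw [Finset.sum_range_succ]
        have : 2 * m + 1 - s + s = 2 * m + 1 := by omega
        linarith [ih]
    have h4 : 2 * m * m = 2 * m ^ 2 := by ring
    omega
  have hA : ∏ i ∈ Finset.range n, (x ^ (n + n) + x ^ (1 - s) * (x ^ 2) ^ i) =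
      (∏ i ∈ Finset.range n, x ^ (2 * i + 1 - s)) *
        ∏ i ∈ Finset.range n, (1 + x ^ (2 * i + 1 + s)) := by
    -- In the lower half the second summand has the smaller exponent; factoring it out lists the
    -- remaining factors in reverse order.
    rw [← Finset.prod_range_reflect (fun i => 1 + x ^ (2 * i + 1 + s)), ← Finset.prod_mul_distrib]
    refine Finset.prod_congr rfl fun i hi => ?_
    have hi := Finset.mem_range.1 hi
    rw [mul_add, mul_one, ← pow_mul, ← pow_add, ← pow_add, add_comm]
    congr 2 <;> omega
  have hB : ∏ i ∈ Finset.range n, (x ^ (n + n) + x ^ (1 - s) * (x ^ 2) ^ (n + i)) =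
      (∏ i ∈ Finset.range n, x ^ (2 * n)) * ∏ i ∈ Finset.range n, (1 + x ^ (2 * i + 1 - s)) := by
    rw [← Finset.prod_mul_distrib]
    refine Finset.prod_congr rfl fun i hi => ?_
    have e1 : n + n = 2 * n := by omega
    have e2 : 1 - s + 2 * (n + i) = 2 * n + (2 * i + 1 - s) := by omega
    rw [mul_add, mul_one, ← pow_mul, ← pow_add, ← pow_add, e1, e2]
  rw [hA, hB, ← h3, Finset.prod_mul_distrib]
  ring

end QSeries

/-! ### Congruences modulo powers of X. -/

section Congruence

open PowerSeries

/-- Congruence of power series modulo `X ^ m`. -/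
def XCongr (m : ℕ) (f g : ℚ⟦X⟧) : Prop := X ^ m ∣ f - g

namespace XCongr

variable {m : ℕ} {f g h f' g' : ℚ⟦X⟧}

theorem refl (f : ℚ⟦X⟧) : XCongr m f f := by simp [XCongr]

theorem symm (H : XCongr m f g) : XCongr m g f := by
  rw [XCongr, ← neg_sub]; exact (dvd_neg.2 H)

theorem trans (H : XCongr m f g) (H' : XCongr m g h) : XCongr m f h := by
  have := dvd_add H H'
  rwa [sub_add_sub_cancel] at this

theorem mono {n : ℕ} (hn : n ≤ m) (H : XCongr m f g) : XCongr n f g := (pow_dvd_pow X hn).trans H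

theorem add (H : XCongr m f g) (H' : XCongr m f' g') : XCongr m (f + f') (g + g') := by
  have := dvd_add H H'
  rwa [sub_add_sub_comm] at this

theorem mul (H : XCongr m f g) (H' : XCongr m f' g') : XCongr m (f * f') (g * g') := by
  have := dvd_add (H.mul_right f') (H'.mul_left g)
  rw [XCongr]; convert this using 1; ring

theorem X_pow_mul (k : ℕ) (H : XCongr m f g) : XCongr (k + m) (X ^ k * f) (X ^ k * g) := by
  rw [XCongr, ← mul_sub, pow_add]; exact mul_dvd_mul_left _ H

theorem sum {ι : Type*} {s : Finset ι} {F G : ι → ℚ⟦X⟧} (H : ∀ i ∈ s, XCongr m (F i) (G i)) :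
    XCongr m (∑ i ∈ s, F i) (∑ i ∈ s, G i) := by
  rw [XCongr, ← Finset.sum_sub_distrib]; exact Finset.dvd_sum H

theorem prod {ι : Type*} {s : Finset ι} {F G : ι → ℚ⟦X⟧} (H : ∀ i ∈ s, XCongr m (F i) (G i)) :
    XCongr m (∏ i ∈ s, F i) (∏ i ∈ s, G i) := by
  classical
  induction s using Finset.induction_on with
  | empty => simpa using refl 1
  | insert a s ha ih =>
    rw [Finset.prod_insert ha, Finset.prod_insert ha]
    exact (H a (by simp)).mul (ih fun i hi => H i (by simp [hi]))

theorem cancel_right (hu : constantCoeff h ≠ 0) (H : XCongr m (f * h) (g * h)) : XCongr m f g := by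
  have hu' : IsUnit h := isUnit_iff_constantCoeff.2 hu.isUnit
  rw [XCongr, ← sub_mul] at H
  exact hu'.dvd_mul_right.1 H

theorem iff_coeff : XCongr m f g ↔ ∀ k < m, coeff k f = coeff k g := by
  rw [XCongr, X_pow_dvd_iff]
  simp [sub_eq_zero]

theorem one_add_X_pow_mul {k : ℕ} (hk : m ≤ k) (f : ℚ⟦X⟧) : XCongr m (1 + X ^ k * f) 1 := by
  rw [XCongr, add_sub_cancel_left]
  exact (pow_dvd_pow X hk).mul_right f

end XCongr

theorem constantCoeff_qFac {k : ℕ} (hk : k ≠ 0) (n : ℕ) :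
    constantCoeff (qFac (X ^ k : ℚ⟦X⟧) n) = 1 := by
  simp [qFac, hk]

theorem gaussBinom_mul_qFac_congr (k n j : ℕ) (hj : j ≤ n) :
    XCongr (k * (n - j + 1)) (gaussBinom (X ^ k) n j * qFac (X ^ k) j) 1 := by
  obtain ⟨m, rfl⟩ := Nat.exists_eq_add_of_le' hj
  rw [gaussBinom_mul_qFac]
  refine (XCongr.prod (G := fun _ => 1) fun i _ => ?_).trans
    (by rw [Finset.prod_const_one]; exact XCongr.refl 1)
  rw [sub_eq_add_neg, ← pow_mul, ← mul_neg_one]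
  exact XCongr.one_add_X_pow_mul (Nat.mul_le_mul_left k (by omega)) _

theorem qFac_congr (k a b : ℕ) (h : a ≤ b) :
    XCongr (k * (a + 1)) (qFac (X ^ k) b) (qFac (X ^ k) a) := by
  rw [qFac, ← Finset.prod_range_mul_prod_Ico _ h, ← qFac]
  have h1 : XCongr (k * (a + 1)) (∏ i ∈ Finset.Ico a b, (1 - (X ^ k) ^ (i + 1))) 1 := by
    refine (XCongr.prod (G := fun _ => 1) fun i hi => ?_).trans
      (by rw [Finset.prod_const_one]; exact XCongr.refl 1)
    have hi := (Finset.mem_Ico.1 hi).1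
    rw [sub_eq_add_neg, ← pow_mul, ← mul_neg_one]
    exact XCongr.one_add_X_pow_mul (Nat.mul_le_mul_left k (by omega)) _
  have h2 := (XCongr.refl (qFac (X ^ k) a)).mul h1
  rwa [mul_one] at h2

theorem qFac_sq (j : ℕ) : qFac (X ^ 2 : ℚ⟦X⟧) j =
    qFac (X ^ 1) j * ∏ i ∈ Finset.range j, (1 + X ^ (i + 1)) := by
  rw [qFac, qFac, ← Finset.prod_mul_distrib]
  exact Finset.prod_congr rfl fun i _ => by ring

/-- Multiplied by (x²;x²)_j = (x;x)_j ∏_{i ≤ j} (1 + x^i), both sides become congruent to the full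
product ∏_{i ≤ n} (1 + x^i). -/
theorem gaussBinom_mul_prod_congr (n j : ℕ) (hj : j ≤ n) :
    XCongr (n - j + 1) (gaussBinom X n j * ∏ i ∈ Finset.Ico j n, (1 + X ^ (i + 1)))
      (gaussBinom (X ^ 2) n j * ∏ i ∈ Finset.range n, (1 + X ^ (i + 1))) := by
  have hu : constantCoeff (qFac (X ^ 2 : ℚ⟦X⟧) j) ≠ 0 := by
    rw [constantCoeff_qFac two_ne_zero]; exact one_ne_zero
  refine XCongr.cancel_right hu ?_
  set P : ℚ⟦X⟧ := ∏ i ∈ Finset.range n, (1 + X ^ (i + 1)) with hP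
  have hP' : (∏ i ∈ Finset.range j, (1 + X ^ (i + 1))) *
      (∏ i ∈ Finset.Ico j n, (1 + X ^ (i + 1))) = P :=
    Finset.prod_range_mul_prod_Ico _ hj
  have h1 := (gaussBinom_mul_qFac_congr 1 n j hj).mul (XCongr.refl P)
  have h2 := ((gaussBinom_mul_qFac_congr 2 n j hj).mono (by omega : 1 * (n - j + 1) ≤ _)).mul
    (XCongr.refl P)
  have h3 := h1.trans h2.symm
  rw [one_mul] at h3
  convert h3 using 1
  · rw [qFac_sq, ← hP', pow_one]; ring
  · ring

/-- Lebesgue's identity modulo `X ^ (n + 1)`. -/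
theorem sum_powerset_prod_congr (z : ℚ⟦X⟧) (n : ℕ) :
    XCongr (n + 1) (∑ T ∈ (Finset.range n).powerset, (∏ i ∈ T, X ^ (i + 1)) *
      ∏ i ∈ Finset.range T.card, (1 + z * X ^ (i + 1)))
    ((∏ i ∈ Finset.range n, (1 + X ^ (i + 1))) *
      ∏ i ∈ Finset.range n, (1 + z * X ^ (2 * (i + 1)))) := by
  have h1 : ∏ i ∈ Finset.range n, (1 + z * X ^ (2 * (i + 1))) =
      ∏ i ∈ Finset.range n, (1 + (z * X ^ 2) * (X ^ 2) ^ i) :=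
    Finset.prod_congr rfl fun i _ => by ring
  rw [sum_powerset_prod, h1, prod_add_mul_pow, Finset.mul_sum]
  refine XCongr.sum fun j hj => ?_
  have hj : j ≤ n := by simpa [Nat.lt_succ_iff] using hj
  -- The j-th term carries X^(2j), which more than makes up for the j lost in the precision n - j +
  -- 1.
  have h2 := ((gaussBinom_mul_prod_congr n j hj).X_pow_mul (j * 2)).mul
    (XCongr.refl (z ^ j * (X ^ 2) ^ j.choose 2))
  have h3 := h2.mono (n := n + 1) (by omega)
  · convert h3 using 1 <;> ring

/-- Jacobi's triple product identity modulo `X ^ (2 * n)`, at two special values. -/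
theorem triple_product_congr (s n : ℕ) (hs : s ≤ 1) :
    XCongr (2 * n) (qFac (X ^ 2) n * ((∏ i ∈ Finset.range n, (1 + X ^ (2 * i + 1 - s))) *
      ∏ i ∈ Finset.range n, (1 + X ^ (2 * i + 1 + s))))
    (∑ w ∈ Finset.Icc (-n : ℤ) n, X ^ (w ^ 2 - s * w).toNat) := by
  have h := prod_mul_prod_eq_sum_gaussBinom (X : ℚ⟦X⟧) s n hs
  have hexp : ∀ k ≤ 2 * n, k * (k - s) + 2 * n * (2 * n - k) = 3 * n ^ 2 - s * n +
      (((k : ℤ) - n) ^ 2 - s * ((k : ℤ) - n)).toNat := by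
    intro k hk
    have hn : s * n ≤ 3 * n ^ 2 := by nlinarith
    have hw : 0 ≤ ((k : ℤ) - n) ^ 2 - s * ((k : ℤ) - n) := by
      interval_cases s
      · simp; positivity
      · rcases le_or_gt (k : ℤ) n with h | h <;> push_cast <;> nlinarith
    zify [hn, hk]
    rw [Int.toNat_of_nonneg hw]
    have : (k : ℤ) * ((k - s : ℕ) : ℤ) = k * (k - s) := by
      rcases Nat.eq_zero_or_pos k with rfl | hk
      · simp
      · rw [Nat.cast_sub (by omega)]
    rw [this]; ring
  have h2 : (∏ i ∈ Finset.range n, (1 + X ^ (2 * i + 1 - s))) *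
      ∏ i ∈ Finset.range n, (1 + X ^ (2 * i + 1 + s)) =
      ∑ w ∈ Finset.Icc (-n : ℤ) n, gaussBinom (X ^ 2 : ℚ⟦X⟧) (2 * n) (w + n).toNat *
        X ^ (w ^ 2 - s * w).toNat := by
    refine mul_left_cancel₀ (pow_ne_zero (3 * n ^ 2 - s * n) (X_ne_zero (R := ℚ))) ?_
    rw [h, Finset.mul_sum]
    refine Finset.sum_bij' (fun k _ => (k : ℤ) - n) (fun w _ => (w + n).toNat) ?_ ?_ ?_ ?_ ?_
    · intro k hk; simp at hk ⊢; omega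
    · intro k hk; simp at hk ⊢; omega
    · intro k hk; simp
    · intro k hk; simp at hk ⊢; omega
    · intro k hk
      rw [hexp k (by simp at hk; omega), pow_add]
      simp
      ring
  rw [h2, Finset.mul_sum]
  refine XCongr.sum fun w hw => ?_
  obtain ⟨hw1, hw2⟩ := Finset.mem_Icc.1 hw
  obtain ⟨k, hk⟩ : ∃ k : ℕ, (k : ℤ) = w + n := ⟨(w + n).toNat, by omega⟩
  have hk' : (w + n).toNat = k := by omega
  have hk2 : k ≤ 2 * n := by omega
  rw [hk']
  obtain ⟨r, hr⟩ : ∃ r : ℕ, (r : ℤ) = n - |w| + 1 :=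
    ⟨(n - |w| + 1).toNat, Int.toNat_of_nonneg (by have := abs_le.2 ⟨hw1, hw2⟩; omega)⟩
  have h3 : XCongr (2 * r) (qFac (X ^ 2) n) (qFac (X ^ 2) k) := by
    rcases le_total k n with hkn | hkn
    · rw [abs_of_nonpos (by omega)] at hr
      exact (qFac_congr 2 k n hkn).mono (by omega)
    · rw [abs_of_nonneg (by omega)] at hr
      exact (qFac_congr 2 n k hkn).symm.mono (by omega)
  have h4 : XCongr (2 * r) (gaussBinom (X ^ 2) (2 * n) k * qFac (X ^ 2) k) 1 :=
    (gaussBinom_mul_qFac_congr 2 (2 * n) k hk2).mono (by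
      have := neg_abs_le w; have := le_abs_self w; omega)
  have h5 := (((XCongr.refl (gaussBinom (X ^ 2) (2 * n) k)).mul h3).trans h4).X_pow_mul
    (w ^ 2 - s * w).toNat
  have h6 := h5.mono (n := 2 * n) (by
    -- The coefficient is 1 modulo X^(2(n-|w|+1)); this bound on the exponent of the theta term
    -- restores precision 2n.
    have h7 : 2 * |w| ≤ w ^ 2 - s * w + 2 := by
      have h8 : 0 ≤ (w - 1) * (w - 2) := by
        rcases le_or_gt w 1 with h | h <;> nlinarith
      clear * - hs h8
      rcases abs_cases w with ⟨h, _⟩ | ⟨h, _⟩ <;> rw [h] <;> interval_cases s <;> push_cast <;>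
        nlinarith [sq_nonneg (w - 1), sq_nonneg (w + 1)]
    have := Int.self_le_toNat (w ^ 2 - s * w)
    omega)
  rw [mul_one] at h6
  convert h6 using 1
  ring

end Congruence

/-! ### Ladder sequences and their reflections. -/

section Ladders

/-- With `c` nodes in the `l`-th ladder, the number of components whose part of the ladder is
full (the components have `l + 1 - d` and `l + 1` positions there, filled in this order). -/
def fullness (d l c : ℕ) : ℕ :=
  (if l + 1 ≤ c + d then 1 else 0) + (if 2 * l + 2 ≤ c + d then 1 else 0)

/-- The upper bound imposed on the `l`-th entry of a ladder sequence by the previous one. -/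
def ladderUpper (d : ℕ) (C : ℕ → ℕ) : ℕ → ℕ
  | 0 => 2 - d
  | l + 1 => C l + fullness d l (C l)

/-- The lower bound imposed on the `l`-th entry of a ladder sequence by the next one. -/
def ladderLower (d : ℕ) (C : ℕ → ℕ) (l : ℕ) : ℕ := C (l + 1) - fullness d (l + 1) (C (l + 1))

/-- The sequences counting the nodes of a restricted bipartition along ladders. -/
def IsLadder (d : ℕ) (C : ℕ → ℕ) : Prop := ∀ l, C l ≤ ladderUpper d C l

/-- Reflection of the entries whose index has parity `e`. -/
def ladderReflect (d e : ℕ) (C : ℕ → ℕ) (l : ℕ) : ℕ :=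
  if l % 2 = e then ladderUpper d C l + ladderLower d C l - C l else C l

variable {d e : ℕ} {C : ℕ → ℕ}

/-- One constraint between neighbours can be read either as an upper bound on the later entry or as
a lower bound on the earlier one. This is what makes the entries of one parity range over
independent intervals. -/
theorem fullness_adjunction (hd : d ≤ 1) {l a b : ℕ} (ha : a + d ≤ 2 * l + 2)
    (hb : b + d ≤ 2 * l + 4) :
    b ≤ a + fullness d l a ↔ b - fullness d (l + 1) b ≤ a := by
  unfold fullness
  split_ifs <;> omega

theorem IsLadder.upper_le (hd : d ≤ 1) (h : IsLadder d C) (l : ℕ) :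
    ladderUpper d C l + d ≤ 2 * l + 2 := by
  induction l with
  | zero => simp [ladderUpper]; omega
  | succ l ih =>
    have h1 := h l
    simp only [ladderUpper, fullness]
    split_ifs <;> omega

theorem IsLadder.add_le (hd : d ≤ 1) (h : IsLadder d C) (l : ℕ) : C l + d ≤ 2 * l + 2 := by
  have := h.upper_le hd l; have := h l; omega

theorem IsLadder.lower_le (hd : d ≤ 1) (h : IsLadder d C) (l : ℕ) : ladderLower d C l ≤ C l :=
  (fullness_adjunction hd (h.add_le hd l) (h.add_le hd (l + 1))).1 (h (l + 1))

theorem ladderReflect_of_ne {l : ℕ} (h : l % 2 ≠ e) : ladderReflect d e C l = C l := if_neg h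

theorem ladderUpper_reflect {l : ℕ} (h : l % 2 = e) :
    ladderUpper d (ladderReflect d e C) l = ladderUpper d C l := by
  obtain _ | l := l
  · rfl
  · have : l % 2 ≠ e := by omega
    simp only [ladderUpper, ladderReflect_of_ne this]

theorem ladderLower_reflect {l : ℕ} (h : l % 2 = e) :
    ladderLower d (ladderReflect d e C) l = ladderLower d C l := by
  have : (l + 1) % 2 ≠ e := by omega
  simp only [ladderLower, ladderReflect_of_ne this]

theorem ladderReflect_add (h : IsLadder d C) {l : ℕ} (hl : l % 2 = e) :
    ladderReflect d e C l + C l = ladderUpper d C l + ladderLower d C l := by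
  have := h l
  rw [ladderReflect, if_pos hl]; omega

theorem ladderReflect_reflect (h : IsLadder d C) :
    ladderReflect d e (ladderReflect d e C) = C := by
  funext l
  by_cases hl : l % 2 = e
  · have h1 := ladderReflect_add h hl
    rw [ladderReflect, if_pos hl, ladderUpper_reflect hl, ladderLower_reflect hl]
    omega
  · rw [ladderReflect_of_ne hl, ladderReflect_of_ne hl]

theorem IsLadder.reflect (hd : d ≤ 1) (h : IsLadder d C) : IsLadder d (ladderReflect d e C) := by
  intro l
  by_cases hl : l % 2 = e
  · rw [ladderUpper_reflect hl]
    have := ladderReflect_add h hl; have := h.lower_le hd l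
    omega
  · rw [ladderReflect_of_ne hl]
    obtain _ | l := l
    · exact h 0
    · by_cases hl' : l % 2 = e
      · have h1 := ladderReflect_add h hl'
        have h2 := h.lower_le hd l
        have h3 := h.upper_le hd l
        have h4 := h l
        refine (fullness_adjunction hd (by omega) (h.add_le hd (l + 1))).2 ?_
        rw [ladderLower] at h1
        omega
      · have := h (l + 1)
        simpa only [ladderUpper, ladderReflect_of_ne hl'] using this

theorem fullness_le (hd : d ≤ 1) (l c : ℕ) : fullness d (l + 1) c ≤ c := by
  unfold fullness
  split_ifs <;> omega

theorem fullness_succ_zero (hd : d ≤ 1) (l : ℕ) : fullness d (l + 1) 0 = 0 :=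
  Nat.le_zero.1 (fullness_le hd l 0)

theorem ladderLower_add (hd : d ≤ 1) (C : ℕ → ℕ) (l : ℕ) :
    ladderLower d C l + fullness d (l + 1) (C (l + 1)) = C (l + 1) :=
  Nat.sub_add_cancel (fullness_le hd _ _)

/-- Summing upper plus lower bounds over odd positions, the fullness terms telescope. The constant d
is `fullness d 0 (C 0) - C 0`, valid because C 0 ≤ 2 - d. -/
theorem sum_ladderReflect_one (hd : d ≤ 1) (h : IsLadder d C) (N : ℕ) :
    ∑ l ∈ Finset.range N, ladderReflect d 1 C (2 * l + 1) + ∑ l ∈ Finset.range N, C (2 * l + 1) +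
      fullness d (2 * N) (C (2 * N)) = 2 * ∑ l ∈ Finset.range N, C (2 * l) + d + C (2 * N) := by
  induction N with
  | zero =>
    have := h.add_le hd 0
    simp only [Finset.range_zero, Finset.sum_empty, fullness]
    simp only [mul_zero, zero_add] at *
    split_ifs <;> omega
  | succ N ih =>
    simp only [Finset.sum_range_succ]
    have h1 := ladderReflect_add (e := 1) h (l := 2 * N + 1) (by omega)
    have h2 := ladderLower_add hd C (2 * N + 1)
    rw [ladderUpper] at h1
    rw [show 2 * (N + 1) = 2 * N + 1 + 1 by ring]
    omega

/-- The same telescoping; here the constant 2 - d is the upper bound at position 0. -/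
theorem sum_ladderReflect_zero (hd : d ≤ 1) (h : IsLadder d C) (N : ℕ) :
    ∑ l ∈ Finset.range (N + 1), ladderReflect d 0 C (2 * l) +
      ∑ l ∈ Finset.range (N + 1), C (2 * l) + fullness d (2 * N + 1) (C (2 * N + 1)) + d =
    2 * ∑ l ∈ Finset.range N, C (2 * l + 1) + 2 + C (2 * N + 1) := by
  induction N with
  | zero =>
    have h1 := ladderReflect_add (e := 0) h (l := 0) (by omega)
    have h2 := ladderLower_add hd C 0
    simp only [ladderUpper, zero_add, Finset.sum_range_succ, Finset.sum_range_zero, mul_zero] at *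
    omega
  | succ N ih =>
    rw [Finset.sum_range_succ _ (N + 1), Finset.sum_range_succ (fun l => C (2 * l)) (N + 1),
      Finset.sum_range_succ (fun l => C (2 * l + 1)) N]
    have h1 := ladderReflect_add (e := 0) h (l := 2 * N + 1 + 1) (by omega)
    have h2 := ladderLower_add hd C (2 * N + 1 + 1)
    rw [ladderUpper] at h1
    rw [show 2 * (N + 1) = 2 * N + 1 + 1 by ring]
    omega

/-- The ladder sequences with given sums over the even and the odd positions. -/
def ladderSet (d : ℕ) (n₀ n₁ : ℤ) : Set (ℕ → ℕ) :=
  {C | IsLadder d C ∧ ∃ N, (∀ l, 2 * N ≤ l → C l = 0) ∧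
    ((∑ l ∈ Finset.range N, C (2 * l) : ℕ) : ℤ) = n₀ ∧
    ((∑ l ∈ Finset.range N, C (2 * l + 1) : ℕ) : ℤ) = n₁}

theorem ladderSet_bound {n₀ n₁ : ℤ} (h : C ∈ ladderSet d n₀ n₁) (M : ℕ) :
    ∃ N, M ≤ N ∧ (∀ l, 2 * N ≤ l → C l = 0) ∧
    ((∑ l ∈ Finset.range N, C (2 * l) : ℕ) : ℤ) = n₀ ∧
    ((∑ l ∈ Finset.range N, C (2 * l + 1) : ℕ) : ℤ) = n₁ := by
  obtain ⟨-, N, h0, h1, h2⟩ := h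
  refine ⟨N + M, by omega, fun l hl => h0 l (by omega), ?_, ?_⟩
  · rw [← h1, Finset.sum_range_add,
      Finset.sum_eq_zero (s := Finset.range M) fun l _ => h0 (2 * (N + l)) (by omega), add_zero]
  · rw [← h2, Finset.sum_range_add,
      Finset.sum_eq_zero (s := Finset.range M) fun l _ => h0 (2 * (N + l) + 1) (by omega), add_zero]

/-- Reflection may lengthen the support by one. The bound 1 ≤ N matters: for d = 1 an empty ladder 0
still has fullness 1, which allows a nonzero entry at position 1. -/
theorem ladderReflect_eq_zero (hd : d ≤ 1) {N : ℕ} (hN : 1 ≤ N) (h : ∀ l, N ≤ l → C l = 0)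
    {l : ℕ} (hl : N + 1 ≤ l) : ladderReflect d e C l = 0 := by
  obtain ⟨l, rfl⟩ : ∃ k, l = k + 1 + 1 := ⟨l - 2, by omega⟩
  have := fullness_succ_zero hd l
  rw [ladderReflect, ladderUpper, ladderLower, h _ (by omega), h (l + 1 + 1) (by omega),
    h (l + 1 + 1 + 1) (by omega), this]
  simp

theorem ladderReflect_one_mem (hd : d ≤ 1) {n₀ n₁ : ℤ} (h : C ∈ ladderSet d n₀ n₁) :
    ladderReflect d 1 C ∈ ladderSet d n₀ (2 * n₀ - n₁ + d) := by
  obtain ⟨N, hN, h0, h1, h2⟩ := ladderSet_bound h 1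
  have h3 := sum_ladderReflect_one hd h.1 (N + 1)
  have h4 : ∀ l, ladderReflect d 1 C (2 * l) = C (2 * l) :=
    fun l => ladderReflect_of_ne (by omega)
  have h5 := fullness_succ_zero hd (2 * N + 1)
  refine ⟨h.1.reflect hd, N + 1,
    fun l hl => ladderReflect_eq_zero hd (by omega) h0 (by omega), ?_, ?_⟩
  · simp only [h4]
    rw [Finset.sum_range_succ, h0 _ (by omega), add_zero, h1]
  · rw [Finset.sum_range_succ _ N, Finset.sum_range_succ (fun l => C (2 * l + 1)) N,
      Finset.sum_range_succ (fun l => C (2 * l)) N, h0 (2 * (N + 1)) (by omega),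
      h0 (2 * N + 1) (by omega), h0 (2 * N) (by omega),
      show 2 * (N + 1) = 2 * N + 1 + 1 by ring, h5] at h3
    rw [Finset.sum_range_succ]
    omega

theorem ladderReflect_zero_mem (hd : d ≤ 1) {n₀ n₁ : ℤ} (h : C ∈ ladderSet d n₀ n₁) :
    ladderReflect d 0 C ∈ ladderSet d (2 * n₁ - n₀ + 2 - d) n₁ := by
  obtain ⟨N, hN, h0, h1, h2⟩ := ladderSet_bound h 1
  have h3 := sum_ladderReflect_zero hd h.1 N
  have h4 : ∀ l, ladderReflect d 0 C (2 * l + 1) = C (2 * l + 1) :=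
    fun l => ladderReflect_of_ne (by omega)
  have h5 := fullness_succ_zero hd (2 * N)
  refine ⟨h.1.reflect hd, N + 1,
    fun l hl => ladderReflect_eq_zero hd (by omega) h0 (by omega), ?_, ?_⟩
  · rw [Finset.sum_range_succ (fun l => C (2 * l)) N, h0 (2 * N) (by omega),
      h0 (2 * N + 1) (by omega), h5] at h3
    omega
  · simp only [h4]
    rw [Finset.sum_range_succ, h0 _ (by omega), add_zero, h2]

theorem ncard_ladderSet_reflect_one (hd : d ≤ 1) (n₀ n₁ : ℤ) :
    (ladderSet d n₀ (2 * n₀ - n₁ + d)).ncard = (ladderSet d n₀ n₁).ncard := by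
  refine (Set.ncard_congr (fun C _ => ladderReflect d 1 C)
    (fun C hC => ladderReflect_one_mem hd hC) (fun C D hC hD hCD => ?_) fun C hC => ?_).symm
  · rw [← ladderReflect_reflect (e := 1) hC.1, hCD, ladderReflect_reflect hD.1]
  · refine ⟨_, ?_, ladderReflect_reflect (e := 1) hC.1⟩
    have h := ladderReflect_one_mem hd hC
    rwa [show 2 * n₀ - (2 * n₀ - n₁ + d) + d = n₁ by ring] at h

theorem ncard_ladderSet_reflect_zero (hd : d ≤ 1) (n₀ n₁ : ℤ) :
    (ladderSet d (2 * n₁ - n₀ + 2 - d) n₁).ncard = (ladderSet d n₀ n₁).ncard := by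
  refine (Set.ncard_congr (fun C _ => ladderReflect d 0 C)
    (fun C hC => ladderReflect_zero_mem hd hC) (fun C D hC hD hCD => ?_) fun C hC => ?_).symm
  · rw [← ladderReflect_reflect (e := 0) hC.1, hCD, ladderReflect_reflect hD.1]
  · refine ⟨_, ?_, ladderReflect_reflect (e := 0) hC.1⟩
    have h := ladderReflect_zero_mem hd hC
    rwa [show 2 * n₁ - (2 * n₁ - n₀ + 2 - d) + 2 - d = n₀ by ring] at h

end Ladders

/-! ### Ladders of a single 2-restricted partition. -/

namespace YoungDiagram

/-- Restrictedness becomes closure under moving down-left along an antidiagonal, so each ladder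
fills its columns from the left. -/
theorem isRestricted_two_iff {l : YoungDiagram} :
    l.IsRestricted 2 ↔ ∀ r c, (r, c + 1) ∈ l → (r + 1, c) ∈ l := by
  constructor
  · intro h r c hc
    have h1 := h r (mem_iff_lt_colLen.1 (l.up_left_mem le_rfl (Nat.zero_le _) hc))
    rw [mem_iff_lt_rowLen] at hc ⊢
    omega
  · intro h r _
    by_contra! hr
    have := h r (l.rowLen (r + 1)) (mem_iff_lt_rowLen.2 (by omega))
    rw [mem_iff_lt_rowLen] at this
    omega

/-- The number of cells in the `m`-th ladder, the antidiagonal of index `m`. -/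
def ladderLen (l : YoungDiagram) (m : ℕ) : ℕ := (l.cells.filter fun x => x.1 + x.2 = m).card

theorem ladderLen_eq_card_range (l : YoungDiagram) (m : ℕ) :
    l.ladderLen m = ((Finset.range (m + 1)).filter fun c => (m - c, c) ∈ l).card := by
  refine Finset.card_nbij' (fun x => x.2) (fun c => (m - c, c)) ?_ ?_ ?_ ?_
  · rintro ⟨r, c⟩ h
    simp only [Finset.coe_filter, Set.mem_ofPred_eq, mem_cells, Finset.mem_range] at h ⊢
    obtain ⟨h, rfl⟩ := h
    exact ⟨by omega, by simpa using h⟩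
  · intro c h
    simp only [Finset.coe_filter, Set.mem_ofPred_eq, mem_cells, Finset.mem_range] at h ⊢
    exact ⟨h.2, by omega⟩
  · rintro ⟨r, c⟩ h
    simp only [Finset.coe_filter, Set.mem_ofPred_eq, mem_cells] at h ⊢
    simp only [Prod.mk.injEq, and_true]; omega
  · intro c _; rfl

theorem ladderLen_le (l : YoungDiagram) (m : ℕ) : l.ladderLen m ≤ m + 1 := by
  rw [ladderLen_eq_card_range]
  simpa using Finset.card_filter_le (Finset.range (m + 1)) fun c => (m - c, c) ∈ l

theorem ladderLen_eq_of_mem_iff {l : YoungDiagram} {m n : ℕ} (hn : n ≤ m + 1)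
    (h : ∀ r c, r + c = m → ((r, c) ∈ l ↔ c < n)) : l.ladderLen m = n := by
  rw [ladderLen_eq_card_range, ← Finset.card_range n]
  congr 1
  ext c
  simp only [Finset.mem_filter, Finset.mem_range]
  constructor
  · rintro ⟨h1, h2⟩; exact (h _ _ (by omega)).1 h2
  · intro h1; exact ⟨by omega, (h _ _ (by omega)).2 h1⟩

theorem IsRestricted.mem_iff_lt_ladderLen {l : YoungDiagram} (h : l.IsRestricted 2) {r c : ℕ} :
    (r, c) ∈ l ↔ c < l.ladderLen (r + c) := by
  rw [isRestricted_two_iff] at h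
  have hdown : ∀ k r c, (r, c + k) ∈ l → (r + k, c) ∈ l := by
    intro k
    induction k with
    | zero => simp
    | succ k ih =>
      intro r c hc
      have := ih (r + 1) c (h r (c + k) (by rwa [add_assoc]))
      rwa [add_right_comm, add_assoc] at this
  rw [ladderLen_eq_card_range]
  constructor
  · intro hc
    rw [← Nat.succ_le_iff, Nat.succ_eq_add_one, ← Finset.card_range (c + 1)]
    refine Finset.card_le_card fun b hb => ?_
    have hb := Finset.mem_range.1 hb
    rw [Finset.mem_filter, Finset.mem_range]
    refine ⟨by omega, ?_⟩
    have := hdown (c - b) r b (by rwa [Nat.add_sub_cancel' (by omega)])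
    rwa [show r + c - b = r + (c - b) by omega]
  · intro hc
    by_contra hn
    refine absurd hc (not_lt.2 ?_)
    refine (Finset.card_le_card (t := Finset.range c) fun b hb => ?_).trans (by simp)
    rw [Finset.mem_filter, Finset.mem_range] at hb
    rw [Finset.mem_range]
    by_contra hbc
    refine hn ?_
    have := hdown (b - c) (r + c - b) c (by rw [Nat.add_sub_cancel' (by omega)]; exact hb.2)
    rwa [show r + c - b + (b - c) = r by omega] at this

theorem IsRestricted.ladderLen_pos_iff {l : YoungDiagram} (h : l.IsRestricted 2) {m : ℕ} :
    0 < l.ladderLen m ↔ m < l.colLen 0 := by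
  rw [← mem_iff_lt_colLen, h.mem_iff_lt_ladderLen, add_zero]

theorem IsRestricted.ladderLen_full_iff {l : YoungDiagram} (h : l.IsRestricted 2) {m : ℕ} :
    l.ladderLen m = m + 1 ↔ m < l.rowLen 0 := by
  rw [← mem_iff_lt_rowLen, h.mem_iff_lt_ladderLen, zero_add]
  have := l.ladderLen_le m
  omega

/-- If ladder m is not full, the last node of a longer ladder m + 1 would have above it a node of
ladder m in a column beyond its length. -/
theorem IsRestricted.ladderLen_succ_le {l : YoungDiagram} (h : l.IsRestricted 2) (m : ℕ) :
    l.ladderLen (m + 1) ≤ l.ladderLen m + if l.ladderLen m = m + 1 then 1 else 0 := by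
  by_cases hf : l.ladderLen m = m + 1
  · have := l.ladderLen_le (m + 1)
    rw [if_pos hf]; omega
  · rw [if_neg hf, add_zero]
    by_contra! hlt
    have hm := l.ladderLen_le m
    have h1 : (m - l.ladderLen m + 1, l.ladderLen m) ∈ l := by
      rw [h.mem_iff_lt_ladderLen]
      rwa [show m - l.ladderLen m + 1 + l.ladderLen m = m + 1 by omega]
    have h2 := l.up_left_mem (Nat.le_succ _) le_rfl h1
    rw [h.mem_iff_lt_ladderLen, show m - l.ladderLen m + l.ladderLen m = m by omega] at h2
    omega

end YoungDiagram

/-! ### Bipartitions encoded by ladder sequences. -/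

namespace Multipartition

/-- The numbers of nodes in the ladders of a bipartition, where the second component is
shifted by `d`. -/
def ladderSeq (d : ℕ) (l : Multipartition 2) (m : ℕ) : ℕ :=
  (l 0).ladderLen m + if d ≤ m then (l 1).ladderLen (m - d) else 0

variable {d : ℕ} {t : Fin 2 → ℕ} {l : Multipartition 2}

theorem isRestricted_two_iff (h0 : t 0 = 0) (h1 : t 1 = d) : l.IsRestricted 2 t ↔
    (l 0).IsRestricted 2 ∧ (l 1).IsRestricted 2 ∧ (l 0).colLen 0 ≤ (l 1).rowLen 0 + d := by
  rw [IsRestricted, Fin.forall_fin_two, and_assoc]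
  refine and_congr_right fun _ => and_congr_right fun _ => ⟨fun h => ?_, fun h i hi => ?_⟩
  · have := h 0 (by norm_num)
    simp only [Fin.zero_eta, zero_add, Fin.mk_one, h0, h1] at this
    omega
  · obtain rfl : i = 0 := by omega
    simp only [Fin.zero_eta, zero_add, Fin.mk_one, h0, h1]
    omega

/-- Condition (ii) in ladder terms: the first component receives nodes only once the second
component's part of the ladder is full. Hence the total count determines both parts. -/
theorem full_of_pos (h0 : (l 0).IsRestricted 2) (h1 : (l 1).IsRestricted 2)
    (h : (l 0).colLen 0 ≤ (l 1).rowLen 0 + d) {m : ℕ} (hm : 0 < (l 0).ladderLen m) (hd : d ≤ m) :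
    (l 1).ladderLen (m - d) = m - d + 1 := by
  rw [h0.ladderLen_pos_iff] at hm
  rw [h1.ladderLen_full_iff]
  omega

theorem mem_one_iff (h0 : (l 0).IsRestricted 2) (h1 : (l 1).IsRestricted 2)
    (h : (l 0).colLen 0 ≤ (l 1).rowLen 0 + d) {r c : ℕ} :
    (r, c) ∈ l 1 ↔ c < ladderSeq d l (r + c + d) := by
  rw [h1.mem_iff_lt_ladderLen, ladderSeq, if_pos (by omega), Nat.add_sub_cancel]
  rcases Nat.eq_zero_or_pos ((l 0).ladderLen (r + c + d)) with hz | hp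
  · rw [hz, zero_add]
  · have := full_of_pos h0 h1 h hp (by omega)
    rw [Nat.add_sub_cancel] at this
    omega

theorem mem_zero_iff (hd : d ≤ 1) (h0 : (l 0).IsRestricted 2) (h1 : (l 1).IsRestricted 2)
    (h : (l 0).colLen 0 ≤ (l 1).rowLen 0 + d) {r c : ℕ} :
    (r, c) ∈ l 0 ↔ r + 2 * c + 1 < ladderSeq d l (r + c) + d := by
  rw [h0.mem_iff_lt_ladderLen, ladderSeq]
  have hle := (l 0).ladderLen_le (r + c)
  split_ifs with hdm
  · have hle' := (l 1).ladderLen_le (r + c - d)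
    rcases Nat.eq_zero_or_pos ((l 0).ladderLen (r + c)) with hz | hp
    · omega
    · have := full_of_pos h0 h1 h hp hdm
      omega
  · omega

theorem isLadder_ladderSeq (hd : d ≤ 1) (h0 : (l 0).IsRestricted 2) (h1 : (l 1).IsRestricted 2)
    (h : (l 0).colLen 0 ≤ (l 1).rowLen 0 + d) : IsLadder d (ladderSeq d l) := by
  intro m
  obtain _ | m := m
  · have e0 := (l 0).ladderLen_le 0
    have e1 := (l 1).ladderLen_le 0
    rw [ladderUpper, ladderSeq, Nat.zero_sub]
    split_ifs <;> omega
  · have e0 := h0.ladderLen_succ_le m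
    have b0 := (l 0).ladderLen_le m
    rw [ladderUpper, ladderSeq, if_pos (by omega), fullness, ladderSeq]
    rcases Nat.lt_or_ge m d with hm | hm
    · obtain ⟨rfl, rfl⟩ : m = 0 ∧ d = 1 := by omega
      have e1 := (l 1).ladderLen_le 0
      -- Here the second component has no position in ladder 0, and that empty part counts as full.
      rw [if_neg (by omega), Nat.add_sub_cancel]
      rcases eq_or_ne ((l 0).ladderLen 0) (0 + 1) with hf | hf
      · rw [if_pos hf] at e0
        split_ifs <;> omega
      · rw [if_neg hf] at e0
        split_ifs <;> omega
    · rw [if_pos hm]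
      have e1 := h1.ladderLen_succ_le (m - d)
      have b1 := (l 1).ladderLen_le (m - d)
      rw [show m - d + 1 = m + 1 - d by omega] at e1 b1
      rcases Nat.eq_zero_or_pos ((l 0).ladderLen (m + 1)) with hz | hp
      · split_ifs at * <;> omega
      · have f1 := full_of_pos h0 h1 h hp (by omega)
        have f2 : (l 1).ladderLen (m - d) = m - d + 1 := by
          rw [h1.ladderLen_full_iff] at f1 ⊢; omega
        split_ifs at * <;> omega

theorem eq_of_ladderSeq_eq (hd : d ≤ 1) (h0 : t 0 = 0) (h1 : t 1 = d) {l' : Multipartition 2}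
    (h : l.IsRestricted 2 t) (h' : l'.IsRestricted 2 t) (H : ladderSeq d l = ladderSeq d l') :
    l = l' := by
  obtain ⟨a, b, c⟩ := (isRestricted_two_iff h0 h1).1 h
  obtain ⟨a', b', c'⟩ := (isRestricted_two_iff h0 h1).1 h'
  have e0 : l 0 = l' 0 := YoungDiagram.ext <| Finset.ext fun ⟨i, j⟩ => by
    rw [YoungDiagram.mem_cells, YoungDiagram.mem_cells, mem_zero_iff hd a b c,
      mem_zero_iff hd a' b' c', H]
  have e1 : l 1 = l' 1 := YoungDiagram.ext <| Finset.ext fun ⟨i, j⟩ => by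
    rw [YoungDiagram.mem_cells, YoungDiagram.mem_cells, mem_one_iff a b c,
      mem_one_iff a' b' c', H]
  funext s
  fin_cases s
  · exact e0
  · exact e1

end Multipartition

/-- A lower set of cells with bounded coordinates, as a Young diagram. -/
theorem YoungDiagram.exists_mem_iff (p : ℕ → ℕ → Prop) (N : ℕ) (hN : ∀ r c, p r c → r < N ∧ c < N)
    (h0 : ∀ r c, p (r + 1) c → p r c) (h1 : ∀ r c, p r (c + 1) → p r c) :
    ∃ l : YoungDiagram, ∀ r c, (r, c) ∈ l ↔ p r c := by
  classical
  have h0' : ∀ k r c, p (r + k) c → p r c := by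
    intro k; induction k with
    | zero => simp
    | succ k ih => exact fun r c h => ih r c (h0 _ _ h)
  have h1' : ∀ k r c, p r (c + k) → p r c := by
    intro k; induction k with
    | zero => simp
    | succ k ih => exact fun r c h => ih r c (h1 _ _ h)
  refine ⟨⟨(Finset.range N ×ˢ Finset.range N).filter fun x => p x.1 x.2, ?_⟩, fun r c => ?_⟩
  · rintro ⟨r, c⟩ ⟨r', c'⟩ ⟨hr, hc⟩ h
    simp only [Finset.coe_filter, Finset.mem_product, Finset.mem_range, Set.mem_ofPred_eq] at h ⊢
    simp only at hr hc
    have hp : p r' c' := by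
      refine h0' (r - r') r' c' (h1' (c - c') _ _ ?_)
      rw [Nat.add_sub_cancel' hr, Nat.add_sub_cancel' hc]
      exact h.2
    exact ⟨hN _ _ hp, hp⟩
  · rw [← YoungDiagram.mem_cells]
    simp only [Finset.mem_filter, Finset.mem_product, Finset.mem_range]
    exact ⟨fun h => h.2, fun h => ⟨hN _ _ h, h⟩⟩

namespace Multipartition

variable {d : ℕ} {t : Fin 2 → ℕ}

/-- The inverse encoding: C m nodes fill the second component's m + 1 - d positions first, and the
overflow goes to the first component. -/
theorem exists_ladderSeq_eq (hd : d ≤ 1) (h0 : t 0 = 0) (h1 : t 1 = d) {C : ℕ → ℕ}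
    (hC : IsLadder d C) {N : ℕ} (hN : ∀ m, N ≤ m → C m = 0) :
    ∃ l : Multipartition 2, l.IsRestricted 2 t ∧ ladderSeq d l = C := by
  have hcap := hC.add_le hd
  have hstep : ∀ m, C (m + 1) ≤ C m + ((if m + 1 ≤ C m + d then 1 else 0) +
    (if 2 * m + 2 ≤ C m + d then 1 else 0)) := fun m => hC (m + 1)
  have hb : ∀ m, 0 < C m → m < N := fun m hm => by
    by_contra h; rw [hN m (by omega)] at hm; omega
  obtain ⟨l0, hl0⟩ := YoungDiagram.exists_mem_iff (fun r c => r + 2 * c + 1 < C (r + c) + d) N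
    (fun r c h => by have := hb (r + c) (by omega); omega)
    (fun r c h => by
      have := hstep (r + c)
      rw [show r + 1 + c = r + c + 1 by ring] at h
      split_ifs at this <;> omega)
    (fun r c h => by
      have := hstep (r + c)
      rw [show r + (c + 1) = r + c + 1 by ring] at h
      split_ifs at this <;> omega)
  obtain ⟨l1, hl1⟩ := YoungDiagram.exists_mem_iff (fun r c => c < C (r + c + d)) N
    (fun r c h => by have := hb (r + c + d) (by omega); omega)
    (fun r c h => by
      have := hstep (r + c + d)
      rw [show r + 1 + c + d = r + c + d + 1 by ring] at h
      split_ifs at this <;> omega)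
    (fun r c h => by
      have := hstep (r + c + d)
      rw [show r + (c + 1) + d = r + c + d + 1 by ring] at h
      split_ifs at this <;> omega)
  refine ⟨![l0, l1], (isRestricted_two_iff h0 h1).2 ⟨?_, ?_, ?_⟩, ?_⟩
  · refine YoungDiagram.isRestricted_two_iff.2 fun r c h => ?_
    rw [Matrix.cons_val_zero, hl0] at h ⊢
    rw [show r + (c + 1) = r + 1 + c by ring] at h
    omega
  · refine YoungDiagram.isRestricted_two_iff.2 fun r c h => ?_
    rw [Matrix.cons_val_one, Matrix.cons_val_zero, hl1] at h ⊢
    rw [show r + (c + 1) = r + 1 + c by ring] at h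
    omega
  -- A first-column node of `l0` in ladder `l1.rowLen 0 + d` would force the second component's part
  -- of that ladder to be full, adding a node to the top row of `l1`.
  · by_contra! hlt
    rw [Matrix.cons_val_zero, Matrix.cons_val_one, Matrix.cons_val_zero,
      ← YoungDiagram.mem_iff_lt_colLen, hl0] at hlt
    have : (0, l1.rowLen 0) ∈ l1 := by rw [hl1]; simp only [zero_add, add_zero] at hlt ⊢; omega
    rw [YoungDiagram.mem_iff_lt_rowLen] at this
    omega
  · funext m
    have e0 : l0.ladderLen m = C m + d - (m + 1) :=
      YoungDiagram.ladderLen_eq_of_mem_iff (by have := hcap m; omega) fun r c h => by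
        rw [hl0, h]; omega
    simp only [ladderSeq, Matrix.cons_val_zero, Matrix.cons_val_one]
    have := hcap m
    split_ifs with hm
    · have e1 : l1.ladderLen (m - d) = min (C m) (m - d + 1) :=
        YoungDiagram.ladderLen_eq_of_mem_iff (min_le_right _ _) fun r c h => by
          rw [hl1, h, Nat.sub_add_cancel hm]; omega
      omega
    · omega

theorem card_filter_shift_eq (l : YoungDiagram) (d m : ℕ) :
    (l.cells.filter fun x => x.1 + x.2 + d = m).card = if d ≤ m then l.ladderLen (m - d) else 0 := by
  split_ifs with h
  · rw [YoungDiagram.ladderLen]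
    congr 1
    refine Finset.filter_congr fun x _ => ?_
    omega
  · rw [Finset.card_eq_zero, Finset.filter_eq_empty_iff]
    intro x _
    omega

theorem card_filter_nodes (l : Multipartition 2) (p : (Σ _ : Fin 2, ℕ × ℕ) → Prop)
    [DecidablePred p] : (l.nodes.filter p).card =
      ((l 0).cells.filter fun x => p ⟨0, x⟩).card + ((l 1).cells.filter fun x => p ⟨1, x⟩).card := by
  rw [Finset.card_filter, nodes, Finset.sum_sigma, Fin.sum_univ_two, Finset.card_filter,
    Finset.card_filter]

theorem card_nodes (l : Multipartition 2) : l.nodes.card = l.size := by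
  rw [nodes, Finset.card_sigma, size]

theorem card_nodes_ladder (h0 : t 0 = 0) (h1 : t 1 = d) (l : Multipartition 2) (m : ℕ) :
    (l.nodes.filter fun x => x.2.1 + x.2.2 + t x.1 = m).card = ladderSeq d l m := by
  rw [card_filter_nodes]
  simp only [h0, h1]
  rw [card_filter_shift_eq, card_filter_shift_eq, ladderSeq,
    if_pos (Nat.zero_le m), Nat.sub_zero]

theorem residue_eq (x : Σ _ : Fin 2, ℕ × ℕ) :
    residue 2 t x = ((x.2.1 + x.2.2 + t x.1 : ℕ) : ZMod 2) := by
  rw [residue, sub_eq_add_neg, ZMod.neg_eq_self_mod_two]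
  push_cast
  ring

theorem residueCount_eq_sum (h0 : t 0 = 0) (h1 : t 1 = d) {l : Multipartition 2} {N : ℕ}
    (hN : ∀ m, 2 * N ≤ m → ladderSeq d l m = 0) {e : ℕ} (he : e < 2) :
    residueCount t l (e : ZMod 2) = ∑ k ∈ Finset.range N, ladderSeq d l (2 * k + e) := by
  have hres : ∀ x : (Σ _ : Fin 2, ℕ × ℕ),
      residue 2 t x = (e : ZMod 2) ↔ (x.2.1 + x.2.2 + t x.1) % 2 = e := by
    intro x
    rw [residue_eq, ZMod.natCast_eq_natCast_iff', Nat.mod_eq_of_lt he]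
  rw [residueCount]
  simp only [hres]
  rw [Finset.card_eq_sum_card_fiberwise (f := fun x => (x.2.1 + x.2.2 + t x.1) / 2)
    (t := Finset.range N)]
  · refine Finset.sum_congr rfl fun k _ => ?_
    rw [Finset.filter_filter, ← card_nodes_ladder h0 h1]
    congr 1
    refine Finset.filter_congr fun x _ => ?_
    omega
  · intro x hx
    rw [Finset.mem_coe, Finset.mem_filter] at hx
    rw [Finset.mem_coe, Finset.mem_range]
    by_contra! hlt
    have h2 := hN (x.2.1 + x.2.2 + t x.1) (by omega)
    rw [← card_nodes_ladder h0 h1, Finset.card_eq_zero, Finset.filter_eq_empty_iff] at h2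
    exact h2 hx.1 rfl

theorem residueCount_add (l : Multipartition 2) :
    residueCount t l 0 + residueCount t l 1 = l.size := by
  rw [← card_nodes, residueCount, residueCount,
    ← Finset.card_filter_add_card_filter_not (s := l.nodes) (p := fun x => residue 2 t x = 0)]
  congr 2
  refine Finset.filter_congr fun x _ => ?_
  generalize residue 2 t x = r
  revert r
  decide

theorem exists_ladderSeq_eq_zero (h0 : t 0 = 0) (h1 : t 1 = d) (l : Multipartition 2) :
    ∃ N, ∀ m, 2 * N ≤ m → ladderSeq d l m = 0 := by
  obtain ⟨N, hN⟩ := (l.nodes.image fun x => x.2.1 + x.2.2 + t x.1).bddAbove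
  refine ⟨N + 1, fun m hm => ?_⟩
  rw [← card_nodes_ladder h0 h1, Finset.card_eq_zero, Finset.filter_eq_empty_iff]
  intro x hx hxm
  have := hN (Finset.mem_coe.2 (Finset.mem_image_of_mem _ hx))
  omega

/-- Residue counts are the sums of the ladder sequence over even and odd positions, so the encoding
carries one set bijectively to the other. -/
theorem ncard_restricted_eq_ladderSet (hd : d ≤ 1) (h0 : t 0 = 0) (h1 : t 1 = d) (n₀ n₁ : ℤ) :
    {l : Multipartition 2 | l.IsRestricted 2 t ∧ (residueCount t l 0 : ℤ) = n₀ ∧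
      (residueCount t l 1 : ℤ) = n₁}.ncard = (ladderSet d n₀ n₁).ncard := by
  have key : ∀ (l : Multipartition 2) (N : ℕ), (∀ m, 2 * N ≤ m → ladderSeq d l m = 0) →
      residueCount t l 0 = ∑ k ∈ Finset.range N, ladderSeq d l (2 * k) ∧
      residueCount t l 1 = ∑ k ∈ Finset.range N, ladderSeq d l (2 * k + 1) := fun l N hN =>
    ⟨by simpa using residueCount_eq_sum h0 h1 hN (e := 0) (by norm_num),
      by simpa using residueCount_eq_sum h0 h1 hN (e := 1) (by norm_num)⟩
  refine Set.ncard_congr (fun l _ => ladderSeq d l) ?_ ?_ ?_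
  · rintro l ⟨hl, rfl, rfl⟩
    obtain ⟨a, b, c⟩ := (isRestricted_two_iff h0 h1).1 hl
    obtain ⟨N, hN⟩ := exists_ladderSeq_eq_zero h0 h1 l
    obtain ⟨k0, k1⟩ := key l N hN
    exact ⟨isLadder_ladderSeq hd a b c, N, hN, by rw [k0], by rw [k1]⟩
  · intro l l' hl hl' H
    exact eq_of_ladderSeq_eq hd h0 h1 hl.1 hl'.1 H
  · rintro C ⟨hC, N, hN, e0, e1⟩
    obtain ⟨l, hl, rfl⟩ := exists_ladderSeq_eq hd h0 h1 hC hN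
    obtain ⟨k0, k1⟩ := key l N hN
    exact ⟨l, ⟨hl, by rw [k0, e0], by rw [k1, e1]⟩, rfl⟩

theorem shift_two_zero {a : ℕ} (ha : 1 ≤ a) : shift a 2 0 = 0 := by
  rw [shift, if_pos]; exact ha

theorem ncard_LamRes {a : ℕ} (ha : 1 ≤ a) (hd : d ≤ 1) (h1 : shift a 2 1 = d) {n₀ n₁ : ℤ} {n : ℕ}
    (hn : n₀ + n₁ = n) : (LamRes a 2 (n₀ - n₁) n).ncard = (ladderSet d n₀ n₁).ncard := by
  rw [← ncard_restricted_eq_ladderSet hd (shift_two_zero ha) h1]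
  congr 1
  ext l
  have := residueCount_add (t := shift a 2) l
  simp only [LamRes, Lam, twoResidue, Set.mem_ofPred_eq, and_assoc]
  refine and_congr_right fun _ => ?_
  omega

theorem LamRes_eq_empty {a : ℕ} {w : ℤ} {n : ℕ} (h : ¬ (n : ℤ) ≡ w [ZMOD 2]) :
    LamRes a 2 w n = ∅ := by
  refine Set.eq_empty_of_forall_notMem fun l hl => h ?_
  have h1 := residueCount_add (t := shift a 2) l
  have h2 : l.size = n := hl.1.2
  have h3 : (residueCount (shift a 2) l 0 : ℤ) - (residueCount (shift a 2) l 1 : ℤ) = w := hl.2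
  rw [Int.modEq_iff_dvd]
  omega

end Multipartition

/-! ### 2-restricted partitions as conjugates of strict ones. -/

namespace YoungDiagram

/-- The rows of `l` that are longer than the next row. -/
def steps (l : YoungDiagram) : Finset ℕ :=
  (Finset.range (l.colLen 0)).filter fun i => l.rowLen (i + 1) < l.rowLen i

/-- The length of row `i` is the number of elements of `S` that are at least `i`. -/
def HasSteps (l : YoungDiagram) (S : Finset ℕ) : Prop :=
  ∀ i, l.rowLen i = (S.filter fun s => i ≤ s).card

theorem card_filter_le_eq (S : Finset ℕ) (i : ℕ) : (S.filter fun s => i ≤ s).card =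
    (S.filter fun s => i + 1 ≤ s).card + if i ∈ S then 1 else 0 := by
  rw [← Finset.card_filter_add_card_filter_not (s := S.filter fun s => i ≤ s)
    (p := fun s => i + 1 ≤ s), Finset.filter_filter, Finset.filter_filter]
  congr 1
  · congr 1
    exact Finset.filter_congr fun s _ => by omega
  · have : (S.filter fun s => i ≤ s ∧ ¬ i + 1 ≤ s) = S.filter fun s => s = i :=
      Finset.filter_congr fun s _ => by omega
    rw [this, Finset.filter_eq']
    split_ifs <;> rfl

variable {l l' : YoungDiagram} {S S' : Finset ℕ}

theorem rowLen_eq_zero {i : ℕ} (h : l.colLen 0 ≤ i) : l.rowLen i = 0 := by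
  by_contra h0
  have := mem_iff_lt_rowLen.2 (Nat.pos_of_ne_zero h0)
  rw [mem_iff_lt_colLen] at this
  omega

/-- Consecutive rows differ by 0 or 1, so a row length counts the descents from that row on; the
induction runs upward from the empty rows. -/
theorem IsRestricted.hasSteps (h : l.IsRestricted 2) : l.HasSteps l.steps := by
  have key : ∀ k i, l.colLen 0 ≤ i + k →
      l.rowLen i = (l.steps.filter fun s => i ≤ s).card := by
    intro k
    induction k with
    | zero =>
      intro i hi
      rw [rowLen_eq_zero (by omega), eq_comm, Finset.card_eq_zero, Finset.filter_eq_empty_iff]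
      intro s hs
      have := Finset.mem_range.1 (Finset.mem_filter.1 hs).1
      omega
    | succ k ih =>
      intro i hi
      rw [card_filter_le_eq, ← ih (i + 1) (by omega)]
      have hanti := l.rowLen_anti i (i + 1) (Nat.le_succ i)
      rcases lt_or_ge i (l.colLen 0) with hlt | hge
      · have := h i hlt
        simp only [steps, Finset.mem_filter, Finset.mem_range, hlt, true_and]
        split_ifs <;> omega
      · rw [rowLen_eq_zero hge, rowLen_eq_zero (hge.trans (Nat.le_succ i)), if_neg]
        intro hs
        have := Finset.mem_range.1 (Finset.mem_filter.1 hs).1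
        omega
  exact fun i => key (l.colLen 0) i (by omega)

namespace HasSteps

theorem rowLen_eq (h : l.HasSteps S) (i : ℕ) :
    l.rowLen i = l.rowLen (i + 1) + if i ∈ S then 1 else 0 := by
  rw [h i, h (i + 1), card_filter_le_eq]

theorem isRestricted (h : l.HasSteps S) : l.IsRestricted 2 := by
  intro i _
  have := h.rowLen_eq i
  split_ifs at this <;> omega

theorem eq (h : l.HasSteps S) (h' : l'.HasSteps S) : l = l' :=
  YoungDiagram.ext <| Finset.ext fun ⟨i, j⟩ => by
    rw [mem_cells, mem_cells, mem_iff_lt_rowLen, mem_iff_lt_rowLen, h i, h' i]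

theorem finset_eq (h : l.HasSteps S) (h' : l.HasSteps S') : S = S' := by
  ext i
  have h1 := h.rowLen_eq i
  have h2 := h'.rowLen_eq i
  by_cases a : i ∈ S <;> by_cases b : i ∈ S' <;> simp only [a, b, if_true, if_false] at * <;> omega

theorem rowLen_zero (h : l.HasSteps S) : l.rowLen 0 = S.card := by
  rw [h 0]; simp

theorem colLen_le_iff (h : l.HasSteps S) (k : ℕ) : l.colLen 0 ≤ k ↔ S ⊆ Finset.range k := by
  have h1 : l.colLen 0 ≤ k ↔ l.rowLen k = 0 := by
    rw [← not_lt, ← mem_iff_lt_colLen, mem_iff_lt_rowLen, Nat.pos_iff_ne_zero, not_not]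
  rw [h1, h k, Finset.card_eq_zero, Finset.filter_eq_empty_iff]
  exact forall₂_congr fun s _ => by rw [Finset.mem_range, not_le]

theorem card_eq (h : l.HasSteps S) : l.card = ∑ s ∈ S, (s + 1) := by
  have hS := (h.colLen_le_iff _).1 le_rfl
  have h1 : l.card = ∑ i ∈ Finset.range (l.colLen 0), l.rowLen i := by
    rw [YoungDiagram.card, Finset.card_eq_sum_card_fiberwise (f := Prod.fst)
      (t := Finset.range (l.colLen 0))]
    · exact Finset.sum_congr rfl fun i _ => by rw [rowLen_eq_card, row]
    · rintro ⟨i, j⟩ hij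
      rw [Finset.mem_coe, Finset.mem_range, ← mem_iff_lt_colLen]
      exact l.up_left_mem le_rfl (Nat.zero_le j) (mem_cells _ |>.1 (Finset.mem_coe.1 hij))
  rw [h1]
  simp only [h _, Finset.card_filter]
  rw [Finset.sum_comm]
  refine Finset.sum_congr rfl fun s hs => ?_
  have hs := Finset.mem_range.1 (hS hs)
  rw [← Finset.card_filter, ← Finset.card_range (s + 1)]
  congr 1
  ext i
  simp only [Finset.mem_filter, Finset.mem_range]
  omega

end HasSteps

theorem exists_hasSteps (S : Finset ℕ) : ∃ l : YoungDiagram, l.HasSteps S := by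
  obtain ⟨N, hN⟩ := S.bddAbove
  have hanti : ∀ i, (S.filter fun s => i + 1 ≤ s).card ≤ (S.filter fun s => i ≤ s).card :=
    fun i => by rw [card_filter_le_eq S i]; omega
  obtain ⟨l, hl⟩ := exists_mem_iff (fun r c => c < (S.filter fun s => r ≤ s).card) (N + S.card + 1)
    (fun r c h => by
      obtain ⟨s, hs⟩ := Finset.card_pos.1 (Nat.zero_lt_of_lt h)
      rw [Finset.mem_filter] at hs
      have h1 := hN (Finset.mem_coe.2 hs.1)
      have h2 := Finset.card_filter_le S fun s => r ≤ s
      omega)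
    (fun r c h => h.trans_le (hanti r)) (fun r c h => (Nat.lt_succ_self c).trans h)
  refine ⟨l, fun i => ?_⟩
  refine le_antisymm ?_ ?_ <;> by_contra! hlt
  · rw [← mem_iff_lt_rowLen, hl] at hlt
    exact lt_irrefl _ hlt
  · rw [← hl, mem_iff_lt_rowLen] at hlt
    exact lt_irrefl _ hlt

end YoungDiagram

/-! ### The generating function summed over all residues. -/

namespace Multipartition

open PowerSeries

/-- The generating function of the numbers of multipartitions in `Lam a m n`. -/
noncomputable def totalGenFun (a m : ℕ) : ℚ⟦X⟧ := PowerSeries.mk fun n => ((Lam a m n).ncard : ℚ)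

variable {a d : ℕ}

/-- Pairs of sets of distinct parts, the parts of the second being at most `d` plus the number of
parts of the first; an element `i` stands for the part `i + 1`. -/
def strictPairs (d N : ℕ) : Finset (Σ _ : Finset ℕ, Finset ℕ) :=
  (Finset.range N).powerset.sigma fun T => (Finset.range (T.card + d)).powerset

theorem ncard_Lam_eq_card (ha : 1 ≤ a) (h1 : shift a 2 1 = d) {n N : ℕ} (hN : n ≤ N) :
    (Lam a 2 n).ncard =
      ((strictPairs d N).filter fun x => ∑ i ∈ x.1, (i + 1) + ∑ i ∈ x.2, (i + 1) = n).card := by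
  rw [← Set.ncard_coe_finset]
  refine Set.ncard_congr (fun l _ => ⟨(l 1).steps, (l 0).steps⟩) ?_ ?_ ?_
  · rintro l ⟨hl, hn⟩
    obtain ⟨r0, r1, h⟩ := (isRestricted_two_iff (shift_two_zero ha) h1).1 hl
    rw [size, Fin.sum_univ_two, r0.hasSteps.card_eq, r1.hasSteps.card_eq] at hn
    rw [r0.hasSteps.colLen_le_iff, r1.hasSteps.rowLen_zero] at h
    simp only [strictPairs, Finset.coe_filter, Finset.mem_sigma, Finset.mem_powerset,
      Set.mem_ofPred_eq]
    -- A part is at most the total size n ≤ N, so truncating the first set at N loses nothing.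
    refine ⟨⟨fun i hi => ?_, h⟩, by omega⟩
    have := Finset.single_le_sum (f := fun i => i + 1) (fun _ _ => Nat.zero_le _) hi
    rw [Finset.mem_range]
    omega
  · rintro l l' ⟨hl, -⟩ ⟨hl', -⟩ H
    obtain ⟨r0, r1, -⟩ := (isRestricted_two_iff (shift_two_zero ha) h1).1 hl
    obtain ⟨r0', r1', -⟩ := (isRestricted_two_iff (shift_two_zero ha) h1).1 hl'
    simp only [Sigma.mk.injEq, heq_eq_eq] at H
    funext s
    fin_cases s
    · exact (H.2 ▸ r0.hasSteps : (l 0).HasSteps (l' 0).steps).eq r0'.hasSteps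
    · exact (H.1 ▸ r1.hasSteps : (l 1).HasSteps (l' 1).steps).eq r1'.hasSteps
  · rintro ⟨T, S⟩ h
    simp only [strictPairs, Finset.coe_filter, Finset.mem_sigma, Finset.mem_powerset,
      Set.mem_ofPred_eq] at h
    obtain ⟨⟨-, hS⟩, hn⟩ := h
    obtain ⟨l0, e0⟩ := YoungDiagram.exists_hasSteps S
    obtain ⟨l1, e1⟩ := YoungDiagram.exists_hasSteps T
    refine ⟨![l0, l1], ⟨(isRestricted_two_iff (shift_two_zero ha) h1).2
      ⟨e0.isRestricted, e1.isRestricted, ?_⟩, ?_⟩, ?_⟩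
    · rw [Matrix.cons_val_zero, Matrix.cons_val_one, Matrix.cons_val_zero, e0.colLen_le_iff,
        e1.rowLen_zero]
      exact hS
    · rw [size, Fin.sum_univ_two, Matrix.cons_val_zero, Matrix.cons_val_one, Matrix.cons_val_zero,
        e0.card_eq, e1.card_eq, ← hn, add_comm]
    · rw [Sigma.mk.injEq]
      exact ⟨e1.isRestricted.hasSteps.finset_eq e1, heq_of_eq (e0.isRestricted.hasSteps.finset_eq e0)⟩

theorem totalGenFun_congr_sum (ha : 1 ≤ a) (h1 : shift a 2 1 = d) (N : ℕ) :
    XCongr (N + 1) (totalGenFun a 2) (∑ T ∈ (Finset.range N).powerset,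
      (∏ i ∈ T, X ^ (i + 1)) * ∏ i ∈ Finset.range (T.card + d), (1 + X ^ (i + 1))) := by
  have h2 : ∀ T ∈ (Finset.range N).powerset,
      (∏ i ∈ T, X ^ (i + 1)) * ∏ i ∈ Finset.range (T.card + d), (1 + X ^ (i + 1)) =
      ∑ S ∈ (Finset.range (T.card + d)).powerset,
        (X ^ (∑ i ∈ T, (i + 1) + ∑ i ∈ S, (i + 1)) : ℚ⟦X⟧) := by
    intro T _
    rw [Finset.prod_one_add, Finset.mul_sum]
    refine Finset.sum_congr rfl fun S _ => ?_
    rw [Finset.prod_pow_eq_pow_sum, Finset.prod_pow_eq_pow_sum, pow_add]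
  rw [Finset.sum_congr rfl h2, Finset.sum_sigma', XCongr.iff_coeff]
  intro n hn
  rw [totalGenFun, coeff_mk, ncard_Lam_eq_card ha h1 (Nat.lt_succ_iff.1 hn), Finset.card_filter,
    map_sum, strictPairs]
  push_cast
  refine Finset.sum_congr rfl fun x _ => ?_
  rw [coeff_X_pow]
  simp only [eq_comm]

end Multipartition

/-! ### Infinite products from their truncations. -/

section Products

open PowerSeries Filter

theorem XCongr.eq_of_forall {f g : ℚ⟦X⟧} (h : ∀ N, XCongr N f g) : f = g :=
  PowerSeries.ext fun n => XCongr.iff_coeff.1 (h (n + 1)) n (Nat.lt_succ_self n)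

theorem XCongr.prod_of_range_subset {a : ℕ → ℚ⟦X⟧} (h : ∀ n, XCongr (n + 1) (a n) 1) {N : ℕ}
    {s : Finset ℕ} (hs : Finset.range N ⊆ s) :
    XCongr N (∏ i ∈ s, a i) (∏ i ∈ Finset.range N, a i) := by
  rw [← Finset.prod_sdiff hs]
  have h1 : XCongr N (∏ i ∈ s \ Finset.range N, a i) 1 := by
    refine (XCongr.prod (G := fun _ => 1) fun i hi => ?_).trans
      (by rw [Finset.prod_const_one]; exact XCongr.refl 1)
    rw [Finset.mem_sdiff, Finset.mem_range] at hi
    exact (h i).mono (by omega)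
  simpa using h1.mul (XCongr.refl (∏ i ∈ Finset.range N, a i))

theorem exists_hasProd_of_congr {a : ℕ → ℚ⟦X⟧} (h : ∀ n, XCongr (n + 1) (a n) 1) :
    ∃ P : ℚ⟦X⟧, HasProd a P ∧ ∀ N, XCongr N P (∏ i ∈ Finset.range N, a i) := by
  refine ⟨PowerSeries.mk fun k => coeff k (∏ i ∈ Finset.range (k + 1), a i), ?_, fun N => ?_⟩
  · rw [HasProd, SummationFilter.unconditional_filter, WithPiTopology.tendsto_iff_coeff_tendsto]
    intro k
    refine tendsto_const_nhds.congr' ?_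
    filter_upwards [eventually_ge_atTop (Finset.range (k + 1))] with s hs
    rw [coeff_mk]
    exact (XCongr.iff_coeff.1 (XCongr.prod_of_range_subset h hs) k (Nat.lt_succ_self k)).symm
  · rw [XCongr.iff_coeff]
    intro k hk
    rw [coeff_mk]
    exact (XCongr.iff_coeff.1 (XCongr.prod_of_range_subset h (Finset.range_mono hk)) k
      (Nat.lt_succ_self k)).symm

theorem multipliable_of_congr {a : ℕ → ℚ⟦X⟧} (h : ∀ n, XCongr (n + 1) (a n) 1) :
    Multipliable a := by
  obtain ⟨P, hP, -⟩ := exists_hasProd_of_congr h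
  exact hP.multipliable

theorem tprod_congr_prod {a : ℕ → ℚ⟦X⟧} (h : ∀ n, XCongr (n + 1) (a n) 1) (N : ℕ) :
    XCongr N (∏' i, a i) (∏ i ∈ Finset.range N, a i) := by
  obtain ⟨P, hP, hN⟩ := exists_hasProd_of_congr h
  rw [hP.tprod_eq]
  exact hN N

theorem one_sub_X_pow_inv_mul (n : ℕ) :
    (1 - X ^ (2 * (n + 1)) : ℚ⟦X⟧)⁻¹ * (1 - X ^ (2 * (n + 1))) = 1 :=
  PowerSeries.inv_mul_cancel _ (by simp)

theorem one_sub_X_pow_inv_congr (n : ℕ) : XCongr (n + 1) (1 - X ^ (2 * (n + 1)) : ℚ⟦X⟧)⁻¹ 1 := by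
  refine XCongr.cancel_right (h := 1 - X ^ (2 * (n + 1))) (by simp) ?_
  rw [one_sub_X_pow_inv_mul, one_mul, sub_eq_add_neg, ← mul_neg_one]
  exact (XCongr.one_add_X_pow_mul (by omega) _).symm

theorem factor_congr {e : ℕ → ℕ} (he : ∀ n, n + 1 ≤ e n) (n : ℕ) :
    XCongr (n + 1) ((1 + X ^ e n : ℚ⟦X⟧) * (1 - X ^ (2 * (n + 1)))⁻¹) 1 := by
  have h1 : XCongr (n + 1) (1 + X ^ e n * 1 : ℚ⟦X⟧) 1 := XCongr.one_add_X_pow_mul (he n) 1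
  rw [mul_one] at h1
  simpa using h1.mul (one_sub_X_pow_inv_congr n)

/-- A series is determined by its product with `qFac (X ^ 2) N` for all `N`. -/
theorem eq_tprod_of_mul_qFac_congr {e : ℕ → ℕ} (he : ∀ n, n + 1 ≤ e n) {f : ℚ⟦X⟧}
    (h : ∀ N, XCongr N (f * qFac (X ^ 2) N) (∏ i ∈ Finset.range N, (1 + X ^ e i))) :
    f = ∏' n, ((1 + X ^ e n : ℚ⟦X⟧) * (1 - X ^ (2 * (n + 1)))⁻¹) := by
  refine XCongr.eq_of_forall fun N => XCongr.trans ?_ (tprod_congr_prod (factor_congr he) N).symm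
  refine XCongr.cancel_right (h := qFac (X ^ 2) N)
    (by rw [constantCoeff_qFac two_ne_zero]; exact one_ne_zero) ?_
  have : (∏ i ∈ Finset.range N, ((1 + X ^ e i : ℚ⟦X⟧) * (1 - X ^ (2 * (i + 1)))⁻¹)) *
      qFac (X ^ 2) N = ∏ i ∈ Finset.range N, (1 + X ^ e i) := by
    rw [qFac, ← Finset.prod_mul_distrib]
    refine Finset.prod_congr rfl fun i _ => ?_
    rw [← pow_mul, mul_assoc, one_sub_X_pow_inv_mul, mul_one]
  rw [this]
  exact h N

theorem prod_one_add_X_pow_congr (N : ℕ) :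
    XCongr N (∏ i ∈ Finset.range N, (1 + X ^ (i + 1)) : ℚ⟦X⟧)
      ((∏ i ∈ Finset.range N, (1 + X ^ (2 * i + 1))) *
        ∏ i ∈ Finset.range N, (1 + X ^ (2 * (i + 1)))) := by
  have h1 : ∀ N, ∏ i ∈ Finset.range (2 * N), (1 + X ^ (i + 1) : ℚ⟦X⟧) =
      (∏ i ∈ Finset.range N, (1 + X ^ (2 * i + 1))) *
        ∏ i ∈ Finset.range N, (1 + X ^ (2 * (i + 1))) := by
    intro N
    induction N with
    | zero => simp
    | succ N ih =>
      rw [show 2 * (N + 1) = 2 * N + 1 + 1 by ring, Finset.prod_range_succ, Finset.prod_range_succ,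
        ih, Finset.prod_range_succ _ N, Finset.prod_range_succ _ N]
      ring
  rw [← h1]
  refine (XCongr.prod_of_range_subset (a := fun i => 1 + X ^ (i + 1)) (fun n => ?_)
    (Finset.range_mono (by omega))).symm
  simpa using XCongr.one_add_X_pow_mul (le_refl (n + 1)) 1

end Products

/-! ### The dihedral symmetry of the counts. -/

section Symmetry

/-- The number of ladder sequences with sum `n` and difference `w` between the sums over the even
and the odd positions. -/
noncomputable def ladderCount (d : ℕ) (w n : ℤ) : ℕ :=
  if 2 ∣ n - w then (ladderSet d ((n + w) / 2) ((n - w) / 2)).ncard else 0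

variable {d : ℕ}

theorem ladderCount_eq (n₀ n₁ : ℤ) :
    ladderCount d (n₀ - n₁) (n₀ + n₁) = (ladderSet d n₀ n₁).ncard := by
  rw [ladderCount, if_pos ⟨n₁, by ring⟩]
  congr 2 <;> omega

theorem ladderCount_eq_zero {w n : ℤ} (h : ¬ 2 ∣ n - w) : ladderCount d w n = 0 := if_neg h

theorem ladderCount_neg {w n : ℤ} (hn : n < 0) : ladderCount d w n = 0 := by
  rw [ladderCount]
  split_ifs with h
  · have he : ladderSet d ((n + w) / 2) ((n - w) / 2) = ∅ := by
      refine Set.eq_empty_of_forall_notMem ?_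
      rintro C ⟨-, N, -, h0, h1⟩
      omega
    rw [he, Set.ncard_empty]
  · rfl

theorem ladderCount_reflect_one (hd : d ≤ 1) (w n : ℤ) :
    ladderCount d (-d - w) (n + 2 * w + d) = ladderCount d w n := by
  by_cases h : 2 ∣ n - w
  · obtain ⟨k, hk⟩ := h
    obtain ⟨m, hm⟩ : ∃ m, m = k + w := ⟨_, rfl⟩
    have e1 := ladderCount_eq (d := d) m k
    have e2 := ladderCount_eq (d := d) m (2 * m - k + d)
    rw [ncard_ladderSet_reflect_one hd, ← e1] at e2
    convert e2 using 2 <;> omega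
  · rw [ladderCount_eq_zero h, ladderCount_eq_zero (by omega)]

theorem ladderCount_reflect_zero (hd : d ≤ 1) (w n : ℤ) :
    ladderCount d (2 - d - w) (n + 2 - d - 2 * w) = ladderCount d w n := by
  by_cases h : 2 ∣ n - w
  · obtain ⟨k, hk⟩ := h
    obtain ⟨m, hm⟩ : ∃ m, m = k + w := ⟨_, rfl⟩
    have e1 := ladderCount_eq (d := d) m k
    have e2 := ladderCount_eq (d := d) (2 * k - m + 2 - d) k
    rw [ncard_ladderSet_reflect_zero hd, ← e1] at e2
    convert e2 using 2 <;> omega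
  · rw [ladderCount_eq_zero h, ladderCount_eq_zero (by omega)]

/-- The composite of the two reflections translates w by 2, and each of them fixes n - (w² - (1 -
d)w). -/
theorem ladderCount_add_two (hd : d ≤ 1) (w m : ℤ) :
    ladderCount d (w + 2) (m + ((w + 2) ^ 2 - (1 - d) * (w + 2))) =
      ladderCount d w (m + (w ^ 2 - (1 - d) * w)) := by
  rw [← ladderCount_reflect_one hd w, ← ladderCount_reflect_zero hd (-d - w)]
  congr 1 <;> ring

theorem ladderCount_emod_two (hd : d ≤ 1) (w m : ℤ) :
    ladderCount d w (m + (w ^ 2 - (1 - d) * w)) =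
      ladderCount d (w % 2) (m + ((w % 2) ^ 2 - (1 - d) * (w % 2))) := by
  have key : ∀ k v : ℤ, ladderCount d (v + 2 * k) (m + ((v + 2 * k) ^ 2 - (1 - d) * (v + 2 * k))) =
      ladderCount d v (m + (v ^ 2 - (1 - d) * v)) := by
    intro k v
    induction k using Int.induction_on with
    | zero => simp
    | succ i ih =>
      rw [← ih, ← ladderCount_add_two hd (v + 2 * i)]
      congr 1 <;> ring
    | pred i ih =>
      rw [← ih, ← ladderCount_add_two hd (v + 2 * (-i - 1))]
      congr 1 <;> ring
  have h := key (w / 2) (w % 2)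
  rwa [Int.emod_add_mul_ediv] at h

end Symmetry

/-! ### Dividing the total series by the theta series. -/

namespace Multipartition

open PowerSeries

variable {a d : ℕ}

theorem ncard_LamRes_eq_ladderCount (ha : 1 ≤ a) (hd : d ≤ 1) (h1 : shift a 2 1 = d) (w : ℤ)
    (n : ℕ) : (LamRes a 2 w n).ncard = ladderCount d w n := by
  by_cases h : 2 ∣ (n : ℤ) - w
  · obtain ⟨k, hk⟩ := h
    have e1 := ncard_LamRes ha hd h1 (n₀ := k + w) (n₁ := k) (n := n) (by omega)
    rw [add_sub_cancel_left] at e1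
    rw [e1, ← ladderCount_eq, add_sub_cancel_left]
    congr 1; omega
  · rw [ladderCount_eq_zero h, LamRes_eq_empty, Set.ncard_empty]
    rw [Int.modEq_iff_dvd]; omega

theorem genFun_eq_X_pow_mul (ha : 1 ≤ a) (hd : d ≤ 1) (h1 : shift a 2 1 = d) {w v : ℤ} {e : ℕ}
    (h : ∀ m, ladderCount d w (m + e) = ladderCount d v m) :
    genFun a 2 w = X ^ e * genFun a 2 v := by
  ext n
  rw [coeff_X_pow_mul', genFun, genFun, coeff_mk, ncard_LamRes_eq_ladderCount ha hd h1]
  split_ifs with hn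
  · rw [coeff_mk, ncard_LamRes_eq_ladderCount ha hd h1, ← h, Nat.cast_sub hn, sub_add_cancel]
  · have := h (n - e)
    rw [sub_add_cancel] at this
    rw [this, ladderCount_neg (by omega), Nat.cast_zero]

theorem genFun_one_two (w : ℤ) : genFun 1 2 w = X ^ (w ^ 2).toNat * genFun 1 2 0 := by
  refine genFun_eq_X_pow_mul (d := 1) le_rfl le_rfl rfl fun m => ?_
  rw [Int.toNat_of_nonneg (sq_nonneg w)]
  have h := ladderCount_emod_two (d := 1) le_rfl w m
  simp only [Nat.cast_one, sub_self, zero_mul, sub_zero] at h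
  rw [h]
  rcases Int.emod_two_eq_zero_or_one w with h0 | h0
  · rw [h0]; simp
  -- For d = 1 the reflection w ↦ 1 - w changes parity and merges the two classes; for d = 0 both
  -- reflections preserve parity.
  · rw [h0, ← ladderCount_reflect_zero le_rfl 0 m]
    congr 1
    push_cast
    ring

theorem sq_sub_self_nonneg (w : ℤ) : 0 ≤ w ^ 2 - w := by
  rcases le_or_gt w 0 with h | h <;> nlinarith

theorem genFun_two_two (w : ℤ) : genFun 2 2 w = X ^ (w ^ 2 - w).toNat * genFun 2 2 (w % 2) := by
  refine genFun_eq_X_pow_mul (d := 0) one_le_two zero_le_one rfl fun m => ?_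
  rw [Int.toNat_of_nonneg (sq_sub_self_nonneg w)]
  have h := ladderCount_emod_two (d := 0) zero_le_one w m
  simp only [Nat.cast_zero, sub_zero, one_mul] at h
  rw [h]
  rcases Int.emod_two_eq_zero_or_one w with h0 | h0 <;> rw [h0] <;> simp

theorem abs_twoResidue_le {t : Fin 2 → ℕ} (l : Multipartition 2) : |l.twoResidue t| ≤ l.size := by
  have h1 := residueCount_add (t := t) l
  rw [twoResidue, abs_le]
  omega

theorem totalGenFun_congr_sum_genFun (a N : ℕ) {S : Finset ℤ}
    (hS : ∀ w : ℤ, |w| < N → w ∈ S) : XCongr N (totalGenFun a 2) (∑ w ∈ S, genFun a 2 w) := by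
  rw [XCongr.iff_coeff]
  intro n hn
  have hfin : (Lam a 2 n).Finite := (finite_size_eq 2 n).subset fun _ hl => hl.2
  rw [map_sum, totalGenFun, coeff_mk, Set.ncard_eq_toFinset_card _ hfin,
    Finset.card_eq_sum_card_fiberwise (f := fun l => l.twoResidue (shift a 2)) (t := S)]
  · push_cast
    refine Finset.sum_congr rfl fun w _ => ?_
    rw [genFun, coeff_mk, ← Set.ncard_coe_finset]
    congr 2
    ext l
    simp [LamRes]
  · intro l hl
    have h1 : l.size = n := ((Set.Finite.mem_toFinset hfin).1 (Finset.mem_coe.1 hl)).2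
    refine Finset.mem_coe.2 (hS _ ?_)
    have h2 := abs_twoResidue_le (t := shift a 2) l
    rw [h1] at h2
    exact h2.trans_lt (by exact_mod_cast hn)

theorem genFun_one_two_zero_mul (N : ℕ) : XCongr N (genFun 1 2 0 * qFac (X ^ 2) N)
    (∏ i ∈ Finset.range N, (1 + X ^ (2 * (i + 1)))) := by
  set O : ℚ⟦X⟧ := ∏ i ∈ Finset.range N, (1 + X ^ (2 * i + 1)) with hO
  set E : ℚ⟦X⟧ := ∏ i ∈ Finset.range N, (1 + X ^ (2 * (i + 1))) with hE
  have hO1 : constantCoeff O = 1 := by simp [hO]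
  have h1 := totalGenFun_congr_sum_genFun 1 N (S := Finset.Icc (-N : ℤ) N) fun w hw => by
    rw [abs_lt] at hw; rw [Finset.mem_Icc]; omega
  have h2 := triple_product_congr 0 N zero_le_one
  simp only [Nat.cast_zero, zero_mul, sub_zero, Nat.sub_zero, add_zero] at h2
  rw [Finset.sum_congr rfl fun w _ => genFun_one_two w, ← Finset.sum_mul] at h1
  have h3 := h1.trans ((h2.symm.mono (by omega : N ≤ 2 * N)).mul (XCongr.refl _))
  have h4 := (totalGenFun_congr_sum (a := 1) (d := 1) le_rfl rfl N).mono (Nat.le_succ N)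
  -- The extra factor allowed by d = 1 is split off as 1 + X, leaving Lebesgue's identity at z = X.
  have h5 : ∀ k, ∏ i ∈ Finset.range (k + 1), (1 + X ^ (i + 1) : ℚ⟦X⟧) =
      (1 + X) * ∏ i ∈ Finset.range k, (1 + X * X ^ (i + 1)) := by
    intro k
    rw [Finset.prod_range_succ', mul_comm]
    simp [pow_succ']
  have h6 := (XCongr.refl (1 + X)).mul ((sum_powerset_prod_congr X N).mono (Nat.le_succ N))
  rw [Finset.mul_sum] at h6
  rw [Finset.sum_congr rfl fun T _ => by rw [h5, mul_left_comm]] at h4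
  have h7 : (1 + X) * ∏ i ∈ Finset.range N, (1 + X * X ^ (2 * (i + 1)) : ℚ⟦X⟧) =
      O * (1 + X ^ (2 * N + 1)) := by
    rw [hO, ← Finset.prod_range_succ (fun i => (1 + X ^ (2 * i + 1) : ℚ⟦X⟧)),
      Finset.prod_range_succ' _ N, mul_comm]
    simp [pow_succ']
  have h8 : XCongr N (1 + X ^ (2 * N + 1) : ℚ⟦X⟧) 1 := by
    simpa using XCongr.one_add_X_pow_mul (by omega : N ≤ 2 * N + 1) 1
  rw [mul_left_comm, h7] at h6
  have h9 := (h3.symm.trans (h4.trans h6)).trans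
    ((prod_one_add_X_pow_congr N).mul ((XCongr.refl O).mul h8))
  refine XCongr.cancel_right (h := O * O) (by simp [hO1]) ?_
  convert h9 using 1 <;> ring

theorem genFun_two_two_add_mul (N : ℕ) :
    XCongr N ((genFun 2 2 0 + genFun 2 2 1) * qFac (X ^ 2) N)
      (∏ i ∈ Finset.range N, (1 + X ^ (2 * i + 1))) := by
  set O : ℚ⟦X⟧ := ∏ i ∈ Finset.range N, (1 + X ^ (2 * i + 1)) with hO
  set E : ℚ⟦X⟧ := ∏ i ∈ Finset.range N, (1 + X ^ (2 * (i + 1))) with hE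
  have hE1 : constantCoeff E = 1 := by simp [hE]
  have h1 := totalGenFun_congr_sum_genFun 2 N (S := Finset.Icc (-N : ℤ) N) fun w hw => by
    rw [abs_lt] at hw; rw [Finset.mem_Icc]; omega
  -- The total is summed a second time through ω ↦ 1 - ω, which fixes ω² - ω and swaps parities;
  -- adding the two sums produces G_0 + G_1.
  have h1' := totalGenFun_congr_sum_genFun 2 N
    (S := (Finset.Icc (-N : ℤ) N).image fun w => 1 - w) fun w hw => by
      rw [abs_lt] at hw
      exact Finset.mem_image.2 ⟨1 - w, Finset.mem_Icc.2 (by omega), by ring⟩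
  rw [Finset.sum_image fun x _ y _ h => by simpa using h] at h1'
  have hsum : ∀ w : ℤ, genFun 2 2 w + genFun 2 2 (1 - w) =
      X ^ (w ^ 2 - w).toNat * (genFun 2 2 0 + genFun 2 2 1) := by
    intro w
    rw [genFun_two_two w, genFun_two_two (1 - w), show (1 - w) ^ 2 - (1 - w) = w ^ 2 - w by ring]
    rcases Int.emod_two_eq_zero_or_one w with h0 | h0
    · rw [h0, show (1 - w) % 2 = 1 by omega]; ring
    · rw [h0, show (1 - w) % 2 = 0 by omega]; ring
  have h2 := h1.add h1'
  rw [← Finset.sum_add_distrib, Finset.sum_congr rfl fun w _ => hsum w, ← Finset.sum_mul] at h2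
  have h3 := triple_product_congr 1 N le_rfl
  simp only [Nat.cast_one, one_mul, Nat.add_sub_cancel] at h3
  have h4 := h2.trans ((h3.symm.mono (by omega : N ≤ 2 * N)).mul (XCongr.refl _))
  have h5 := (totalGenFun_congr_sum (a := 2) (d := 0) one_le_two rfl N).mono (Nat.le_succ N)
  have h6 := (sum_powerset_prod_congr 1 N).mono (Nat.le_succ N)
  simp only [one_mul, add_zero] at h5 h6
  have h7 := (h5.trans h6).trans ((prod_one_add_X_pow_congr N).mul (XCongr.refl _))
  -- The factor at i = 0 is 1 + 1; this 2 cancels the doubling of the total.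
  have h8 : XCongr N (∏ i ∈ Finset.range N, (1 + X ^ (2 * i)) : ℚ⟦X⟧) (2 * E) := by
    have e1 : (∏ i ∈ Finset.range N, (1 + X ^ (2 * i)) : ℚ⟦X⟧) * (1 + X ^ (2 * N)) = 2 * E := by
      rw [← Finset.prod_range_succ (fun i => (1 + X ^ (2 * i) : ℚ⟦X⟧)),
        Finset.prod_range_succ' _ N, mul_comm, hE]
      norm_num
    have e2 : XCongr N (1 + X ^ (2 * N) : ℚ⟦X⟧) 1 := by
      simpa using XCongr.one_add_X_pow_mul (by omega : N ≤ 2 * N) 1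
    rw [← e1]
    simpa using ((XCongr.refl (∏ i ∈ Finset.range N, (1 + X ^ (2 * i)) : ℚ⟦X⟧)).mul e2).symm
  have h9 : ∏ i ∈ Finset.range N, (1 + X ^ (2 * i + 1 + 1) : ℚ⟦X⟧) = E := rfl
  rw [h9] at h4
  have h10 := (((XCongr.refl (qFac (X ^ 2) N)).mul (h8.mul (XCongr.refl E))).mul
    (XCongr.refl (genFun 2 2 0 + genFun 2 2 1))).symm.trans (h4.symm.trans (h7.add h7))
  refine XCongr.cancel_right (h := 2 * E * E)
    (by rw [map_mul, map_mul, hE1, map_ofNat]; norm_num) ?_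
  convert h10 using 1 <;> ring

theorem coeff_genFun_eq_zero {a : ℕ} {w : ℤ} {n : ℕ} (h : ¬ (n : ℤ) ≡ w [ZMOD 2]) :
    coeff n (genFun a 2 w) = 0 := by
  rw [genFun, coeff_mk, LamRes_eq_empty h, Set.ncard_empty, Nat.cast_zero]

end Multipartition

theorem mainTheorem3 (ω : ℤ) :
    (Multipliable (fun n : ℕ => (1 + PowerSeries.X ^ (2 * (n + 1)) : PowerSeries ℚ) *
        (1 - PowerSeries.X ^ (2 * (n + 1)))⁻¹) ∧
      Multipartition.genFun 1 2 ω = PowerSeries.X ^ (ω ^ 2).toNat *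
        ∏' n : ℕ, ((1 + PowerSeries.X ^ (2 * (n + 1)) : PowerSeries ℚ) *
          (1 - PowerSeries.X ^ (2 * (n + 1)))⁻¹)) ∧
    (Multipliable (fun n : ℕ => (1 + PowerSeries.X ^ (2 * n + 1) : PowerSeries ℚ) *
        (1 - PowerSeries.X ^ (2 * (n + 1)))⁻¹) ∧
      Multipartition.genFun 2 2 ω = PowerSeries.mk fun k : ℕ =>
        if (k : ℤ) ≡ ω [ZMOD 2] then
          PowerSeries.coeff k (PowerSeries.X ^ (ω ^ 2 - ω).toNat *
            ∏' n : ℕ, ((1 + PowerSeries.X ^ (2 * n + 1) : PowerSeries ℚ) *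
              (1 - PowerSeries.X ^ (2 * (n + 1)))⁻¹))
        else 0) := by
  have he1 : ∀ n, n + 1 ≤ 2 * (n + 1) := fun n => by omega
  have he2 : ∀ n, n + 1 ≤ 2 * n + 1 := fun n => by omega
  refine ⟨⟨multipliable_of_congr (factor_congr he1), ?_⟩,
    multipliable_of_congr (factor_congr he2), ?_⟩
  · rw [Multipartition.genFun_one_two,
      eq_tprod_of_mul_qFac_congr he1 Multipartition.genFun_one_two_zero_mul]
  · rw [← eq_tprod_of_mul_qFac_congr he2 Multipartition.genFun_two_two_add_mul]
    ext k
    rw [PowerSeries.coeff_mk]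
    split_ifs with hk
    · rw [Multipartition.genFun_two_two, mul_add, map_add]
      have heven : 2 ∣ ω ^ 2 - ω := by
        rw [show ω ^ 2 - ω = ω * (ω - 1) by ring]; exact (Int.even_mul_pred_self ω).two_dvd
      have hnn := Multipartition.sq_sub_self_nonneg ω
      -- As ω² - ω is even, multiplying by its power keeps exponents in their parity class, so only
      -- the summand with v ≡ ω contributes.
      have hzero : ∀ v : ℤ, ¬ ω ≡ v [ZMOD 2] → PowerSeries.coeff k
          (PowerSeries.X ^ (ω ^ 2 - ω).toNat * Multipartition.genFun 2 2 v) = 0 := by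
        intro v hv
        rw [PowerSeries.coeff_X_pow_mul']
        split_ifs with hle
        · refine Multipartition.coeff_genFun_eq_zero fun h => hv ?_
          rw [Int.modEq_iff_dvd] at *
          omega
        · rfl
      rcases Int.emod_two_eq_zero_or_one ω with h0 | h0
      · rw [h0, hzero 1 (by rw [Int.ModEq, h0]; decide), add_zero]
      · rw [h0, hzero 0 (by rw [Int.ModEq, h0]; decide), zero_add]
    · exact Multipartition.coeff_genFun_eq_zero hk
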